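/- Call a chain of subgroups $G=G_0>G_1>\cdots>G_t=1$ of a finite group $G$ unrefinable if each $G_i$ is a maximal subgroup of $G_{i-1}$. The depth $\lambda(G)$ is the minimal length $t$ of an unrefinable chain of $G$, and the length $l(G)$ is the maximal length of a strictly descending chain of subgroups from $G$ to $1$. A finite simple group is understood to be non-abelian. For every $n\in\mathbb{N}$ there exists a finite simple group $G$ with $\lambda(G)=3$ and $l(G)>n$. In fact, one may take $G={\rm L}_2(p)={\rm PSL}_2(\mathbb{F}_p)$ for a suitable prime $p$. More precisely, let $n\geqslant 2$, let $p_1,\ldots,p_{n-1}$ be the first $n-1$ primes greater than $5$, and let $S$ be the set of primes $p$ such that $p$ is congruent to one of $3,-3,13,-13$ modulo $40$ and $p\equiv 1 \pmod{p_i}$ for all $i=1,\ldots,n-1$. Then $S$ is infinite and, for every $p\in S$, the group ${\rm L}_2(p)$ is simple, $\lambda({\rm L}_2(p))=3$ and $l({\rm L}_2(p))>n$. -/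

import Mathlib

/-- An unrefinable chain of length `t` of a group `G`: a chain of subgroups
`G = c 0 > c 1 > ⋯ > c t = 1` in which each `c (i + 1)` is a maximal subgroup of `c i`
(there is no subgroup strictly between them, which is the covering relation `⋖` of the
lattice of subgroups of `G`). -/
def IsUnrefinableChain (G : Type*) [Group G] (t : ℕ) (c : Fin (t + 1) → Subgroup G) : Prop :=
  c 0 = ⊤ ∧ c (Fin.last t) = ⊥ ∧ ∀ i : Fin t, c i.succ ⋖ c i.castSucc

/-- A strictly descending chain of subgroups of `G` of length `t`, from `G` to `1`. -/
def IsDescendingChain (G : Type*) [Group G] (t : ℕ) (c : Fin (t + 1) → Subgroup G) : Prop :=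
  c 0 = ⊤ ∧ c (Fin.last t) = ⊥ ∧ ∀ i : Fin t, c i.succ < c i.castSucc

/-- The depth of a group: the minimal length of an unrefinable chain. -/
noncomputable def groupDepth (G : Type*) [Group G] : ℕ∞ :=
  ⨅ (t : ℕ) (_ : ∃ c : Fin (t + 1) → Subgroup G, IsUnrefinableChain G t c), (t : ℕ∞)

/-- The length of a group: the maximal length of a strictly descending chain of subgroups
from the group to its trivial subgroup. -/
noncomputable def groupLength (G : Type*) [Group G] : ℕ∞ :=
  ⨆ (t : ℕ) (_ : ∃ c : Fin (t + 1) → Subgroup G, IsDescendingChain G t c), (t : ℕ∞)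

/-- A finite simple group, in the sense of a finite, non-abelian, simple group. -/
structure IsFiniteNonabelianSimple (G : Type*) [Group G] : Prop where
  finite : Finite G
  simple : IsSimpleGroup G
  nonabelian : ∃ a b : G, a * b ≠ b * a

/-- `L₂(p) = SL₂(𝔽_p) / Z(SL₂(𝔽_p))`, for a prime `p`. -/
abbrev L2 (p : ℕ) : Type := Matrix.ProjectiveSpecialLinearGroup (Fin 2) (ZMod p)

/-- The `i`-th prime greater than `5`, counted from `i = 0`: `7, 11, 13, …`. -/
noncomputable def primeAboveFive (i : ℕ) : ℕ := Nat.nth (fun q => q.Prime ∧ 5 < q) i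

/-- The primes `p` with `p ≡ ±3, ±13 (mod 40)` and `p ≡ 1` modulo each of the first `n - 1`
primes greater than `5` (used for `n ≥ 2`). -/
def admissiblePrimes (n : ℕ) : Set ℕ :=
  {p | p.Prime ∧
    ((p : ℤ) ≡ 3 [ZMOD 40] ∨ (p : ℤ) ≡ -3 [ZMOD 40] ∨
      (p : ℤ) ≡ 13 [ZMOD 40] ∨ (p : ℤ) ≡ -13 [ZMOD 40]) ∧
    ∀ i < n - 1, p ≡ 1 [MOD primeAboveFive i]}

theorem Subgroup.commute_of_zpowers_eq_top {G : Type*} [Group G] {x : G}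
    (hx : Subgroup.zpowers x = ⊤) (a b : G) : a * b = b * a := by
  obtain ⟨m, rfl⟩ := Subgroup.mem_zpowers_iff.1 (hx ▸ Subgroup.mem_top a)
  obtain ⟨n, rfl⟩ := Subgroup.mem_zpowers_iff.1 (hx ▸ Subgroup.mem_top b)
  rw [← zpow_add, ← zpow_add, add_comm]

theorem Subgroup.exists_zpowers_eq_of_bot_covBy {G : Type*} [Group G] {M : Subgroup G}
    (h : ⊥ ⋖ M) : ∃ x, Subgroup.zpowers x = M := by
  obtain ⟨x, hx, hx1⟩ := SetLike.exists_of_lt h.lt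
  refine ⟨x, (h.eq_or_eq bot_le ((Subgroup.zpowers_le).2 hx)).resolve_left fun h0 => hx1 ?_⟩
  exact Subgroup.zpowers_eq_bot.1 h0 ▸ Subgroup.one_mem _

/-- A finite non-abelian simple group has no maximal subgroup that is also minimal. -/
theorem IsSimpleGroup.not_covBy_top_of_bot_covBy {G : Type*} [Group G] [Finite G]
    [IsSimpleGroup G] (hG : ∃ a b : G, a * b ≠ b * a) {M : Subgroup G}
    (h1 : ⊥ ⋖ M) (h2 : M ⋖ ⊤) : False := by
  obtain ⟨x, hx⟩ := Subgroup.exists_zpowers_eq_of_bot_covBy h1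
  have hcomm : ∀ a ∈ M, ∀ b ∈ M, a * b = b * a := by
    rintro a ha b hb
    rw [← hx] at ha hb
    obtain ⟨m, rfl⟩ := Subgroup.mem_zpowers_iff.1 ha
    obtain ⟨n, rfl⟩ := Subgroup.mem_zpowers_iff.1 hb
    rw [← zpow_add, ← zpow_add, add_comm]
  have hM1 : Nat.card M ≠ 1 := fun h => h1.lt.ne' (Subgroup.card_eq_one.1 h)
  obtain ⟨q, hq, hqM⟩ := Nat.exists_prime_and_dvd hM1
  have : Fact q.Prime := ⟨hq⟩
  obtain ⟨y, hy⟩ := exists_prime_orderOf_dvd_card' q hqM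
  have hyM : Subgroup.zpowers (y : G) = M := by
    refine (h1.eq_or_eq bot_le ((Subgroup.zpowers_le).2 y.2)).resolve_left fun h0 => ?_
    have : (y : G) = 1 := Subgroup.zpowers_eq_bot.1 h0
    have : y = 1 := Subtype.ext this
    rw [this, orderOf_one] at hy
    exact hq.one_lt.ne hy
  have hpM : IsPGroup q M := by
    refine IsPGroup.of_card (n := 1) ?_
    rw [← hyM, Nat.card_zpowers, Subgroup.orderOf_coe, hy, pow_one]
  obtain ⟨P, hP⟩ := hpM.exists_le_sylow
  rcases h2.eq_or_eq hP le_top with hPM | hPM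
  · have hN : Subgroup.normalizer (P : Set G) ≤ Subgroup.centralizer (P : Set G) := by
      have hle : M ≤ Subgroup.normalizer (M : Set G) := Subgroup.le_normalizer
      have hPM' : (P : Set G) = M := by rw [← Sylow.coe_coe, hPM]
      rw [hPM']
      rcases h2.eq_or_eq hle le_top with h | h
      · rw [h]
        intro a ha
        rw [Subgroup.mem_centralizer_iff]
        intro b hb
        exact hcomm b hb a ha
      · have hn : M.Normal := Subgroup.normalizer_eq_top_iff.1 h
        rcases hn.eq_bot_or_eq_top with h | h
        · exact absurd h h1.lt.ne'
        · exact absurd h h2.lt.ne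
    have hc := MonoidHom.ker_transferSylow_isComplement' P hN
    rcases (inferInstance : (MonoidHom.transferSylow P hN).ker.Normal).eq_bot_or_eq_top with h | h
    · rw [h, Subgroup.isComplement'_bot_left] at hc
      exact h2.lt.ne (hPM ▸ hc)
    · rw [h, Subgroup.isComplement'_top_left] at hc
      exact h1.lt.ne' (hPM ▸ hc)
  · have hp : IsPGroup q G := by
      have := P.isPGroup'
      rw [hPM] at this
      exact this.of_equiv Subgroup.topEquiv
    have := hp.isNilpotent
    obtain ⟨a, b, hab⟩ := hG
    exact hab (IsSimpleGroup.comm_iff_isSolvable.2 inferInstance a b)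

theorem three_le_groupDepth {G : Type*} [Group G] [Finite G] [IsSimpleGroup G]
    (hG : ∃ a b : G, a * b ≠ b * a) : 3 ≤ groupDepth G := by
  refine le_iInf₂ fun t ⟨c, h0, h1, h2⟩ => ?_
  by_contra hlt
  have ht : t < 3 := by
    rw [not_le] at hlt
    exact_mod_cast hlt
  interval_cases t
  · exact bot_ne_top (h1.symm.trans h0)
  · have h := h2 0
    have e1 : c (Fin.succ 0) = ⊥ := h1
    have e0 : c (Fin.castSucc 0) = ⊤ := h0
    rw [e1, e0] at h
    obtain ⟨x, hx⟩ := Subgroup.exists_zpowers_eq_of_bot_covBy h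
    obtain ⟨a, b, hab⟩ := hG
    exact hab (Subgroup.commute_of_zpowers_eq_top hx a b)
  · have ha := h2 0
    have hb := h2 1
    have e2 : c (Fin.succ 1) = ⊥ := h1
    have e0 : c (Fin.castSucc 0) = ⊤ := h0
    rw [e0] at ha
    rw [e2] at hb
    exact IsSimpleGroup.not_covBy_top_of_bot_covBy hG hb ha

theorem groupDepth_le_three {G : Type*} [Group G] {A C : Subgroup G}
    (hA : A ⋖ ⊤) (hC : C ⋖ A) (h : ⊥ ⋖ C) : groupDepth G ≤ 3 := by
  refine iInf₂_le_of_le 3 ⟨![⊤, A, C, ⊥], rfl, rfl, fun i => ?_⟩ le_rfl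
  fin_cases i
  · exact hA
  · exact hC
  · exact h

theorem le_groupLength {G : Type*} [Group G] {t : ℕ} {c : Fin (t + 1) → Subgroup G}
    (h : IsDescendingChain G t c) : (t : ℕ∞) ≤ groupLength G :=
  le_iSup₂_of_le t ⟨c, h⟩ le_rfl

open Subgroup in
/-- The non-central elements commuting with some conjugate of `x`. -/
def conjCentralizerSet {K : Type*} [Group K] (x : K) : Set K :=
  {s | s ∉ center K ∧ ∃ g : K, Commute (g * x * g⁻¹) s}

section Centralizers

open Subgroup

variable {K : Type*} [Group K]

theorem conj_notMem_center {x : K} (hx : x ∉ center K) (g : K) : g * x * g⁻¹ ∉ center K :=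
  fun h => hx (by simpa [mul_assoc] using (inferInstance : (center K).Normal).conj_mem _ h g⁻¹)

theorem commute_conj_iff {x y g : K} :
    Commute (g * x * g⁻¹) y ↔ Commute x (g⁻¹ * y * g) := by
  rw [← Commute.conj_iff (h := g⁻¹)]
  simp [mul_assoc]

/-- Commuting with a conjugate is a symmetric relation. -/
theorem exists_commute_conj_symm {x y : K} (h : ∃ g : K, Commute (g * x * g⁻¹) y) :
    ∃ g : K, Commute (g * y * g⁻¹) x := by
  obtain ⟨g, hg⟩ := h
  exact ⟨g⁻¹, by simpa using (commute_conj_iff.1 hg).symm⟩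

variable (hcomm : ∀ x y z : K, y ∉ center K → Commute x y → Commute y z → Commute x z)
include hcomm

theorem exists_commute_conj_trans {x y z : K} (hy : y ∉ center K)
    (h : ∃ g : K, Commute (g * x * g⁻¹) y) (h' : ∃ g : K, Commute (g * y * g⁻¹) z) :
    ∃ g : K, Commute (g * x * g⁻¹) z := by
  obtain ⟨g, hg⟩ := h
  obtain ⟨k, hk⟩ := h'
  refine ⟨k * g, hcomm _ (k * y * k⁻¹) _ (conj_notMem_center hy k) ?_ hk⟩
  have := (Commute.conj_iff (h := k)).2 hg
  simpa [mul_assoc] using this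

theorem mem_normalizer_centralizer_iff [Finite K] {x : K} (hx : x ∉ center K) (g : K) :
    g ∈ normalizer (centralizer ({x} : Set K) : Set K) ↔ Commute (g * x * g⁻¹) x := by
  constructor
  · intro h
    have := (mem_normalizer_iff.1 h x).1 (mem_centralizer_singleton_iff.2 rfl)
    exact mem_centralizer_singleton_iff.1 this
  · intro h
    have key : ∀ y, Commute y x ↔ Commute (g * y * g⁻¹) x := fun y => by
      constructor
      · intro hy
        exact hcomm _ _ _ (conj_notMem_center hx g) ((Commute.conj_iff (h := g)).2 hy) h
      · intro hy
        have := hcomm _ _ _ hx hy h.symm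
        exact (Commute.conj_iff (h := g)).1 this
    rw [mem_normalizer_iff]
    intro y
    rw [mem_centralizer_singleton_iff, mem_centralizer_singleton_iff]
    exact key y

theorem card_conjCentralizerSet_mul [Finite K] {x : K} (hx : x ∉ center K) :
    Nat.card K * (Nat.card (centralizer ({x} : Set K)) - Nat.card (center K)) =
      (conjCentralizerSet x).ncard *
        Nat.card (normalizer (centralizer ({x} : Set K) : Set K)) := by
  classical
  have := Fintype.ofFinite K
  have hle : center K ≤ centralizer ({x} : Set K) := center_le_centralizer _
  rw [Nat.card_eq_fintype_card, ← Finset.card_univ, Set.ncard_eq_toFinset_card']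
  refine Finset.card_mul_eq_card_mul (fun g s => Commute (g * x * g⁻¹) s) ?_ ?_
  · intro g _
    have h1 : (Finset.bipartiteAbove (fun g s => Commute (g * x * g⁻¹) s)
        (conjCentralizerSet x).toFinset g : Set K) =
        (fun y => g * y * g⁻¹) '' ((centralizer ({x} : Set K) : Set K) \ center K) := by
      ext s
      have hS : s ∈ conjCentralizerSet x ↔
          s ∉ center K ∧ ∃ g : K, Commute (g * x * g⁻¹) s := Iff.rfl
      simp only [Finset.coe_bipartiteAbove, Set.mem_toFinset, hS, Set.mem_ofPred_eq,
        Set.mem_image, Set.mem_sdiff, SetLike.mem_coe, mem_centralizer_singleton_iff]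
      constructor
      · rintro ⟨⟨hs, -⟩, hc⟩
        refine ⟨g⁻¹ * s * g, ⟨(commute_conj_iff.1 hc).symm, fun h => hs ?_⟩, by group⟩
        simpa [mul_assoc] using (inferInstance : (center K).Normal).conj_mem _ h g
      · rintro ⟨y, ⟨hy, hyc⟩, rfl⟩
        have hy' : Commute (g * x * g⁻¹) (g * y * g⁻¹) :=
          (Commute.conj_iff (h := g)).2 (show Commute y x from hy).symm
        exact ⟨⟨conj_notMem_center hyc g, g, hy'⟩, hy'⟩
    rw [← Set.ncard_coe_finset, h1,
      Set.ncard_image_of_injective (f := fun y => g * y * g⁻¹) _ (MulAut.conj g).injective,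
      Set.ncard_sdiff (SetLike.coe_subset_coe.2 hle)]
    rfl
  · intro s hs
    rw [Set.mem_toFinset] at hs
    obtain ⟨hs, k, hk⟩ := hs
    have h1 : (Finset.bipartiteBelow (fun g s => Commute (g * x * g⁻¹) s)
        Finset.univ s : Set K) =
        (fun y => k * y) '' (normalizer (centralizer ({x} : Set K) : Set K) : Set K) := by
      ext g
      simp only [Finset.coe_bipartiteBelow, Finset.mem_univ, true_and,
        Set.mem_ofPred_eq, Set.mem_image, SetLike.mem_coe]
      have e : ∀ y, Commute ((k * y) * x * (k * y)⁻¹) s ↔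
          y ∈ normalizer (centralizer ({x} : Set K) : Set K) := fun y => by
        rw [mem_normalizer_centralizer_iff hcomm hx]
        have e1 : Commute ((k * y) * x * (k * y)⁻¹) s ↔
            Commute ((k * y) * x * (k * y)⁻¹) (k * x * k⁻¹) :=
          ⟨fun h => hcomm _ _ _ hs h hk.symm,
            fun h => hcomm _ _ _ (conj_notMem_center hx k) h hk⟩
        rw [e1, ← Commute.conj_iff (h := k) (a := y * x * y⁻¹)]
        simp [mul_assoc]
      constructor
      · intro h
        exact ⟨k⁻¹ * g, (e _).1 (by simpa using h), by group⟩
      · rintro ⟨y, hy, rfl⟩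
        exact (e y).2 hy
    rw [← Set.ncard_coe_finset, h1, Set.ncard_image_of_injective _ (mul_right_injective k)]
    rfl

theorem disjoint_conjCentralizerSet {x y : K}
    (h : ¬ ∃ g : K, Commute (g * x * g⁻¹) y) :
    Disjoint (conjCentralizerSet x) (conjCentralizerSet y) := by
  rw [Set.disjoint_left]
  rintro s ⟨hs, hx⟩ ⟨-, hy⟩
  exact h (exists_commute_conj_trans hcomm hs hx (exists_commute_conj_symm hy))

theorem card_normalizer_centralizer [Finite K]
    (hinv : ∀ x g : K, x ∉ center K → Commute (g * x * g⁻¹) x →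
      g * x * g⁻¹ = x ∨ g * x * g⁻¹ = x⁻¹) {x : K} (hx : x ∉ center K) :
    Nat.card (normalizer (centralizer ({x} : Set K) : Set K)) =
        Nat.card (centralizer ({x} : Set K)) ∨
      Nat.card (normalizer (centralizer ({x} : Set K) : Set K)) =
        2 * Nat.card (centralizer ({x} : Set K)) := by
  set C := centralizer ({x} : Set K)
  set N := normalizer (C : Set K)
  have hCN : C ≤ N := le_normalizer
  have hmem : ∀ g ∈ N, g * x * g⁻¹ = x ∨ g * x * g⁻¹ = x⁻¹ := fun g hg =>
    hinv x g hx ((mem_normalizer_centralizer_iff hcomm hx g).1 hg)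
  have hC : ∀ g, g * x * g⁻¹ = x → g ∈ C := fun g hg =>
    mem_centralizer_singleton_iff.2 (by rw [mul_inv_eq_iff_eq_mul] at hg; exact hg)
  have hrel : C.relIndex N ≤ 2 := by
    by_contra hlt
    rw [not_le] at hlt
    have hnot : ¬ N ≤ C := fun h => by
      rw [relIndex_eq_one.2 h] at hlt
      omega
    obtain ⟨g0, hg0, hg0C⟩ := SetLike.not_le_iff_exists.1 hnot
    have hg0x := (hmem g0 hg0).resolve_left fun h => hg0C (hC _ h)
    have : C.relIndex N = 2 := by
      rw [relIndex, index_eq_two_iff]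
      refine ⟨⟨g0, hg0⟩, fun b => ?_⟩
      rcases hmem _ b.2 with h | h
      · refine Or.inr ⟨mem_subgroupOf.2 (hC _ h), fun h' => hg0C ?_⟩
        have h2 := C.mul_mem (C.inv_mem (hC _ h)) (mem_subgroupOf.1 h')
        simpa using h2
      · refine Or.inl ⟨mem_subgroupOf.2 (hC _ ?_), fun h' => hg0C ?_⟩
        · have h1 : (b * g0 : K) * x * (b * g0 : K)⁻¹ = b * (g0 * x * g0⁻¹) * (b : K)⁻¹ := by
            group
          have h3 : (b : K) * x⁻¹ * (b : K)⁻¹ = (b * x * (b : K)⁻¹)⁻¹ := by group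
          change (b * g0 : K) * x * (b * g0 : K)⁻¹ = x
          rw [h1, hg0x, h3, h, inv_inv]
        · have hb : (b : K) ∈ C := mem_subgroupOf.1 h'
          have hb' : (b : K) * x * (b : K)⁻¹ = x := by
            rw [mul_inv_eq_iff_eq_mul]; exact mem_centralizer_singleton_iff.1 hb
          exact hC _ (hg0x.trans (h.symm.trans hb'))
    omega
  have hpos : C.relIndex N ≠ 0 := index_ne_zero_of_finite
  have hmul : Nat.card C * C.relIndex N = Nat.card N := by
    rw [← Nat.card_congr (subgroupOfEquivOfLe hCN).toEquiv]
    exact card_mul_index _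
  have : C.relIndex N = 1 ∨ C.relIndex N = 2 := by omega
  rcases this with h | h <;> rw [h] at hmul
  · left; omega
  · right; omega

end Centralizers

set_option maxHeartbeats 400000 in
open Subgroup in
/-- The class equation for a finite group with a centre of order `2` whose remaining elements
are partitioned by abelian centralizers, each of index at most `2` in its normalizer. -/
theorem Nat.card_eq_twentyfour_of_abelian_centralizers {K : Type*} [Group K] [Finite K]
    (hZ : Nat.card (center K) = 2)
    (hcomm : ∀ x y z : K, y ∉ center K → Commute x y → Commute y z → Commute x z)
    (hinv : ∀ x g : K, x ∉ center K → Commute (g * x * g⁻¹) x →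
      g * x * g⁻¹ = x ∨ g * x * g⁻¹ = x⁻¹)
    {i : K} (hi : i ∉ center K) {m : ℕ} (hm : Odd m)
    (hCi : Nat.card (centralizer ({i} : Set K)) = 4 * m)
    (hNi : Nat.card (normalizer (centralizer ({i} : Set K) : Set K)) = 8 * m)
    (heven : ∀ x ∉ center K, 4 ∣ Nat.card (centralizer ({x} : Set K)) →
      ∃ g, Commute (g * i * g⁻¹) x)
    (h5 : ¬ 5 ∣ Nat.card K) : Nat.card K = 24 := by
  set N : ℕ := Nat.card K with hN
  have hNpos : 0 < N := Nat.card_pos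
  have hNq : (0 : ℚ) < N := by exact_mod_cast hNpos
  have hm1 : 1 ≤ m := hm.pos
  have h8m : 8 * m ≤ N := by
    rw [← hNi]
    exact Nat.le_of_dvd hNpos (card_subgroup_dvd_card _)
  set U : Set K := {s | s ∉ center K} with hU
  have hUcard : (U.ncard : ℚ) = N - 2 := by
    have h1 : U = (Set.univ : Set K) \ center K := by ext; simp [hU]
    have h2 : U.ncard = N - 2 := by
      rw [h1, Set.ncard_sdiff (Set.subset_univ _), Set.ncard_univ, ← hZ]
      rfl
    rw [h2, Nat.cast_sub (by omega)]
    norm_num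
  have hSU : ∀ x, conjCentralizerSet x ⊆ U := fun x s hs => hs.1
  have hself : ∀ x ∈ U, x ∈ conjCentralizerSet x := fun x hx => ⟨hx, 1, by simp⟩
  have hdis : ∀ x y, y ∈ U → y ∉ conjCentralizerSet x →
      Disjoint (conjCentralizerSet x) (conjCentralizerSet y) := fun x y hy h =>
    disjoint_conjCentralizerSet hcomm fun hg => h ⟨hy, hg⟩
  have hSi : ((conjCentralizerSet i).ncard : ℚ) = N * (1 / 2 - 1 / (4 * m)) := by
    have h := card_conjCentralizerSet_mul hcomm hi
    rw [hCi, hNi, hZ] at h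
    have h' : (N : ℚ) * (4 * m - 2) = (conjCentralizerSet i).ncard * (8 * m) := by
      have : ((N * (4 * m - 2) : ℕ) : ℚ) = (((conjCentralizerSet i).ncard * (8 * m) : ℕ) : ℚ) := by
        exact_mod_cast h
      rw [Nat.cast_mul, Nat.cast_sub (by omega)] at this
      push_cast at this
      exact this
    have hm0 : (m : ℚ) ≠ 0 := by positivity
    field_simp
    linarith
  have hodd : ∀ x ∈ U, x ∉ conjCentralizerSet i →
      ∃ R : ℚ, (R = N / 3 ∨ R ≤ N / 7) ∧ 2 ≤ R ∧
        (((conjCentralizerSet x).ncard : ℚ) = N - R ∨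
          ((conjCentralizerSet x).ncard : ℚ) = N / 2 - R / 2) := by
    intro x hx hxi
    have h := card_conjCentralizerSet_mul hcomm hx
    rw [hZ] at h
    set C := Nat.card (centralizer ({x} : Set K))
    have hCN : C ∣ N := card_subgroup_dvd_card _
    have hle : center K ≤ centralizer ({x} : Set K) := center_le_centralizer _
    have h2C : 2 ∣ C := hZ ▸ card_dvd_of_le hle
    have hC2 : C ≠ 2 := fun hC => hx (by
      have : center K = centralizer ({x} : Set K) :=
        eq_of_le_of_card_ge hle (by rw [hZ]; exact hC.le)
      rw [this]
      exact mem_centralizer_singleton_iff.2 rfl)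
    have hC4 : ¬ 4 ∣ C := fun h4 => hxi ⟨hx, heven x hx h4⟩
    have hC5 : ¬ 5 ∣ C := fun h => h5 (h.trans hCN)
    have hCpos : 0 < C := Nat.card_pos
    obtain ⟨c, hc⟩ := h2C
    have hc37 : c = 3 ∨ 7 ≤ c := by omega
    have hcq : (0 : ℚ) < c := by
      have : 0 < c := by omega
      exact_mod_cast this
    obtain ⟨d, hd⟩ := hCN
    have hd0 : d ≠ 0 := by rintro rfl; omega
    refine ⟨N / c, ?_, ?_, ?_⟩
    · rcases hc37 with rfl | h7
      · left; norm_num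
      · right
        have : (7 : ℚ) ≤ c := by exact_mod_cast h7
        gcongr
    · have : ((N : ℕ) : ℚ) = 2 * c * d := by rw [hd, hc]; push_cast; ring
      rw [this]
      have hd1 : (1 : ℚ) ≤ d := by exact_mod_cast Nat.one_le_iff_ne_zero.2 hd0
      field_simp
      linarith
    · have hq : ((N : ℚ)) * (2 * c - 2) = (conjCentralizerSet x).ncard *
          Nat.card (normalizer (centralizer ({x} : Set K) : Set K)) := by
        have : ((N * (C - 2) : ℕ) : ℚ) = _ := congrArg (Nat.cast (R := ℚ)) h
        rw [Nat.cast_mul, Nat.cast_sub (by omega), hc] at this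
        push_cast at this
        exact this
      rcases card_normalizer_centralizer hcomm hinv hx with h1 | h1
      · left
        rw [h1, show Nat.card (centralizer ({x} : Set K)) = 2 * c from hc] at hq
        push_cast at hq
        field_simp
        linarith
      · right
        rw [h1, show Nat.card (centralizer ({x} : Set K)) = 2 * c from hc] at hq
        push_cast at hq
        field_simp
        linarith
  obtain ⟨M, hM, hM2, hSM⟩ : ∃ M : ℚ, (M = N / 4 ∨ M ≤ N / 12) ∧ 2 ≤ M ∧
      ((conjCentralizerSet i).ncard : ℚ) = N / 2 - M := by
    have hmq : (0 : ℚ) < m := by exact_mod_cast hm1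
    refine ⟨N / (4 * m), ?_, ?_, ?_⟩
    · obtain ⟨k, rfl⟩ := hm
      rcases Nat.eq_zero_or_pos k with rfl | hk
      · left; norm_num
      · right
        have : (1 : ℚ) ≤ k := by exact_mod_cast hk
        gcongr
        push_cast
        linarith
    · have : (8 * m : ℚ) ≤ N := by exact_mod_cast h8m
      rw [le_div_iff₀ (by positivity)]
      linarith
    · rw [hSi]; field_simp
  have hthird : ∀ x ∈ U, x ∉ conjCentralizerSet i →
      (N : ℚ) / 3 ≤ (conjCentralizerSet x).ncard := fun x hx hxi => by
    obtain ⟨R, hR, -, hSR | hSR⟩ := hodd x hx hxi <;> rw [hSR] <;>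
      rcases hR with hR | hR <;> linarith
  have key : ∀ T : Set K, (∀ y ∈ U, y ∈ T) ∨ ∃ y ∈ U, y ∉ T := fun T => by
    by_cases h : ∀ y ∈ U, y ∈ T
    · exact Or.inl h
    · push Not at h; exact Or.inr h
  have htot : ∀ T ⊆ U, (∀ y ∈ U, y ∈ T) → (T.ncard : ℚ) = N - 2 := fun T h1 h2 => by
    rw [← hUcard, Set.Subset.antisymm h1 h2]
  have hbound : ∀ T ⊆ U, (T.ncard : ℚ) ≤ N - 2 := fun T h => by
    rw [← hUcard]; exact_mod_cast Set.ncard_le_ncard h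
  suffices h : (N : ℚ) = 24 by exact_mod_cast h
  rcases key (conjCentralizerSet i) with h | ⟨x, hx, hxi⟩
  · have := htot _ (hSU i) h
    linarith
  obtain ⟨R, hR, hR2, hSR⟩ := hodd x hx hxi
  have hTU : conjCentralizerSet i ∪ conjCentralizerSet x ⊆ U := Set.union_subset (hSU i) (hSU x)
  have hT : ((conjCentralizerSet i ∪ conjCentralizerSet x).ncard : ℚ) =
      (conjCentralizerSet i).ncard + (conjCentralizerSet x).ncard := by
    rw [Set.ncard_union_eq (hdis i x hx hxi)]; push_cast; rfl
  have hTb := hbound _ hTU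
  rcases key (conjCentralizerSet i ∪ conjCentralizerSet x) with h | ⟨y, hy, hyT⟩
  · have := htot _ hTU h
    rcases hSR with hSR | hSR <;> rcases hM with hM | hM <;> rcases hR with hR | hR <;> linarith
  rw [Set.mem_union, not_or] at hyT
  obtain ⟨Q, hQ, hQ2, hSQ⟩ := hodd y hy hyT.1
  have hWU : conjCentralizerSet i ∪ conjCentralizerSet x ∪ conjCentralizerSet y ⊆ U :=
    Set.union_subset hTU (hSU y)
  have hW : ((conjCentralizerSet i ∪ conjCentralizerSet x ∪ conjCentralizerSet y).ncard : ℚ) =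
      (conjCentralizerSet i ∪ conjCentralizerSet x).ncard + (conjCentralizerSet y).ncard := by
    rw [Set.ncard_union_eq (Set.disjoint_union_left.2 ⟨hdis i y hy hyT.1, hdis x y hy hyT.2⟩)]
    push_cast; rfl
  have hWb := hbound _ hWU
  rcases key (conjCentralizerSet i ∪ conjCentralizerSet x ∪ conjCentralizerSet y) with
    h | ⟨z, hz, hzW⟩
  · have := htot _ hWU h
    rcases hSR with hSR | hSR <;> rcases hSQ with hSQ | hSQ <;> rcases hM with hM | hM <;>
      rcases hR with hR | hR <;> rcases hQ with hQ | hQ <;> linarith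
  rw [Set.mem_union, not_or, Set.mem_union, not_or] at hzW
  have hVb := hbound _ (Set.union_subset hWU (hSU z))
  rw [Set.ncard_union_eq (Set.disjoint_union_left.2 ⟨Set.disjoint_union_left.2
    ⟨hdis i z hz hzW.1.1, hdis x z hz hzW.1.2⟩, hdis y z hz hzW.2⟩)] at hVb
  push_cast at hVb
  have hSi4 : (N : ℚ) / 4 ≤ (conjCentralizerSet i).ncard := by
    rw [hSM]; rcases hM with hM | hM <;> linarith
  linarith [hthird x hx hxi, hthird y hy hyT.1, hthird z hz hzW.1.1]

open scoped MatrixGroups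

namespace Matrix.SpecialLinearGroup

section Field

variable {F : Type*} [Field F]

theorem det_two (x : SL(2, F)) : x 0 0 * x 1 1 - x 0 1 * x 1 0 = 1 := by
  rw [← Matrix.det_fin_two]; exact x.2

theorem ext_two {x y : SL(2, F)} (h1 : x 0 0 = y 0 0) (h2 : x 0 1 = y 0 1)
    (h3 : x 1 0 = y 1 0) (h4 : x 1 1 = y 1 1) : x = y := by
  ext i j
  fin_cases i <;> fin_cases j <;> assumption

theorem mul_apply_two (x y : SL(2, F)) (i j : Fin 2) :
    (x * y) i j = x i 0 * y 0 j + x i 1 * y 1 j := by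
  simp [Matrix.mul_apply, Fin.sum_univ_two]

theorem inv_apply_two (x : SL(2, F)) : x⁻¹ 0 0 = x 1 1 ∧ x⁻¹ 0 1 = -x 0 1 ∧
    x⁻¹ 1 0 = -x 1 0 ∧ x⁻¹ 1 1 = x 0 0 := by
  simp [Matrix.adjugate_fin_two]

theorem commute_iff_apply (x y : SL(2, F)) : Commute x y ↔
    x 0 1 * y 1 0 = y 0 1 * x 1 0 ∧ x 0 1 * (y 0 0 - y 1 1) = y 0 1 * (x 0 0 - x 1 1) ∧
      x 1 0 * (y 0 0 - y 1 1) = y 1 0 * (x 0 0 - x 1 1) := by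
  constructor
  · intro h
    have h' : ∀ i j, (x * y) i j = (y * x) i j := fun i j => by rw [h.eq]
    simp only [mul_apply_two] at h'
    have h00 := h' 0 0
    have h01 := h' 0 1
    have h10 := h' 1 0
    refine ⟨by linear_combination h00, by linear_combination -h01, by linear_combination h10⟩
  · rintro ⟨h1, h2, h3⟩
    apply ext_two <;> simp only [mul_apply_two]
    · linear_combination h1
    · linear_combination -h2
    · linear_combination h3
    · linear_combination -h1

theorem mem_center_iff_apply (x : SL(2, F)) :
    x ∈ Subgroup.center SL(2, F) ↔ x 0 1 = 0 ∧ x 1 0 = 0 ∧ x 0 0 = x 1 1 := by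
  rw [mem_center_iff]
  constructor
  · rintro ⟨r, -, hr⟩
    simp [← hr]
  · rintro ⟨h1, h2, h3⟩
    refine ⟨x 0 0, ?_, ?_⟩
    · have := det_two x
      rw [h1, ← h3] at this
      rw [Fintype.card_fin]
      linear_combination this
    · ext i j
      fin_cases i <;> fin_cases j <;> simp [h1, h2, h3]

theorem mem_center_iff_eq_one_or_neg_one (x : SL(2, F)) :
    x ∈ Subgroup.center SL(2, F) ↔ x = 1 ∨ x = -1 := by
  rw [mem_center_iff_apply]
  constructor
  · rintro ⟨h1, h2, h3⟩
    have hd := det_two x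
    rw [h1, ← h3] at hd
    have : (x 0 0 - 1) * (x 0 0 + 1) = 0 := by linear_combination hd
    rcases mul_eq_zero.1 this with h | h
    · left
      have h0 : x 0 0 = 1 := by linear_combination h
      apply ext_two <;> simp [h1, h2, ← h3, h0]
    · right
      have h0 : x 0 0 = -1 := by linear_combination h
      apply ext_two <;> simp [h1, h2, ← h3, h0]
  · rintro (rfl | rfl) <;> simp

theorem commute_trans_of_notMem_center {x y z : SL(2, F)} (hy : y ∉ Subgroup.center SL(2, F))
    (hxy : Commute x y) (hyz : Commute y z) : Commute x z := by
  rw [commute_iff_apply] at *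
  rw [mem_center_iff_apply] at hy
  obtain ⟨a1, a2, a3⟩ := hxy
  obtain ⟨b1, b2, b3⟩ := hyz
  by_cases h1 : y 0 1 = 0
  · by_cases h2 : y 1 0 = 0
    · have h3 : y 0 0 - y 1 1 ≠ 0 := fun h => hy ⟨h1, h2, sub_eq_zero.1 h⟩
      rw [h1] at a2 b2
      rw [h2] at a3 b3
      have x1 : x 0 1 = 0 := by simpa [h3] using a2
      have x2 : x 1 0 = 0 := by simpa [h3] using a3
      have z1 : z 0 1 = 0 := by simpa [h3] using b2.symm
      have z2 : z 1 0 = 0 := by simpa [h3] using b3.symm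
      simp [x1, x2, z1, z2]
    · refine ⟨mul_right_cancel₀ h2 ?_, mul_right_cancel₀ h2 ?_, mul_right_cancel₀ h2 ?_⟩
      · linear_combination z 1 0 * a1 + x 1 0 * b1
      · linear_combination (z 0 0 - z 1 1) * a1 + (x 0 0 - x 1 1) * b1 +
          (x 1 0 * (z 0 0 - z 1 1) - z 1 0 * (x 0 0 - x 1 1)) * h1
      · linear_combination z 1 0 * a3 + x 1 0 * b3
  · have h : x 0 1 * (z 0 0 - z 1 1) = z 0 1 * (x 0 0 - x 1 1) := by
      apply mul_right_cancel₀ h1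
      linear_combination z 0 1 * a2 + x 0 1 * b2
    refine ⟨mul_right_cancel₀ h1 ?_, h, mul_right_cancel₀ h1 ?_⟩
    · linear_combination z 0 1 * a1 + x 0 1 * b1
    · linear_combination (x 1 1 - x 0 0) * b1 - (z 0 0 - z 1 1) * a1 + y 1 0 * h

/-- An element commuting with a regular semisimple element and having the same trace is that
element or its inverse. -/
theorem eq_or_eq_inv_of_commute (h2 : (2 : F) ≠ 0) {x y : SL(2, F)}
    (hx : x ∉ Subgroup.center SL(2, F)) (hxy : Commute y x)
    (ht : y 0 0 + y 1 1 = x 0 0 + x 1 1) (hne : (x 0 0 + x 1 1) ^ 2 ≠ 4) :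
    y = x ∨ y = x⁻¹ := by
  obtain ⟨b, hb1, hb2, hb3⟩ : ∃ b, y 0 1 = b * x 0 1 ∧ y 1 0 = b * x 1 0 ∧
      y 0 0 - y 1 1 = b * (x 0 0 - x 1 1) := by
    rw [commute_iff_apply] at hxy
    rw [mem_center_iff_apply] at hx
    obtain ⟨a1, a2, a3⟩ := hxy
    by_cases h1 : x 0 1 = 0
    · by_cases h2 : x 1 0 = 0
      · have h3 : x 0 0 - x 1 1 ≠ 0 := fun h => hx ⟨h1, h2, sub_eq_zero.1 h⟩
        refine ⟨(y 0 0 - y 1 1) / (x 0 0 - x 1 1), ?_, ?_, ?_⟩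
        · rw [h1] at a2 ⊢; simpa [h3] using a2
        · rw [h2] at a3 ⊢; simpa [h3] using a3
        · field_simp
      · refine ⟨y 1 0 / x 1 0, ?_, ?_, ?_⟩ <;> field_simp
        · linear_combination a1
        · linear_combination -a3
    · refine ⟨y 0 1 / x 0 1, ?_, ?_, ?_⟩ <;> field_simp
      · linear_combination -a1
      · linear_combination -a2
  have hdx := det_two x
  have hdy := det_two y
  have e0 : 2 * y 0 0 = (x 0 0 + x 1 1) + b * (x 0 0 - x 1 1) := by linear_combination ht + hb3
  have e1 : 2 * y 1 1 = (x 0 0 + x 1 1) - b * (x 0 0 - x 1 1) := by linear_combination ht - hb3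
  have hb : (b - 1) * (b + 1) * ((x 0 0 + x 1 1) ^ 2 - 4) = 0 := by
    rw [hb1, hb2] at hdy
    have h4 : (2 * y 0 0) * (2 * y 1 1) = 4 + 4 * (b * x 0 1 * (b * x 1 0)) := by
      linear_combination 4 * hdy
    rw [e0, e1] at h4
    linear_combination (-1 : F) * h4 + 4 * b ^ 2 * hdx
  have hb' : b = 1 ∨ b = -1 := by
    rcases mul_eq_zero.1 hb with h | h
    · rcases mul_eq_zero.1 h with h | h
      · left; linear_combination h
      · right; linear_combination h
    · exact absurd (sub_eq_zero.1 h) hne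
  obtain ⟨i1, i2, i3, i4⟩ := inv_apply_two x
  rcases hb' with rfl | rfl
  · left
    apply ext_two
    · apply mul_left_cancel₀ h2; linear_combination e0
    · linear_combination hb1
    · linear_combination hb2
    · apply mul_left_cancel₀ h2; linear_combination e1
  · right
    apply ext_two
    · rw [i1]; apply mul_left_cancel₀ h2; linear_combination e0
    · rw [i2]; linear_combination hb1
    · rw [i3]; linear_combination hb2
    · rw [i4]; apply mul_left_cancel₀ h2; linear_combination e1

theorem trace_conj (g x : SL(2, F)) :
    (g * x * g⁻¹) 0 0 + (g * x * g⁻¹) 1 1 = x 0 0 + x 1 1 := by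
  obtain ⟨i1, i2, i3, i4⟩ := inv_apply_two g
  simp only [mul_apply_two, i1, i2, i3, i4]
  linear_combination (x 0 0 + x 1 1) * det_two g

theorem eq_one_or_neg_one_of_sq_eq_one (h2 : (2 : F) ≠ 0) {x : SL(2, F)} (hx : x ^ 2 = 1) :
    x = 1 ∨ x = -1 := by
  have h : x = x⁻¹ := by rw [eq_inv_iff_mul_eq_one, ← sq, hx]
  obtain ⟨i1, i2, i3, i4⟩ := inv_apply_two x
  rw [← h] at i1 i2 i3 i4
  rw [← mem_center_iff_eq_one_or_neg_one, mem_center_iff_apply]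
  refine ⟨?_, ?_, i1⟩
  · apply mul_left_cancel₀ h2; linear_combination i2
  · apply mul_left_cancel₀ h2; linear_combination i3

def upper (s : F) : SL(2, F) := ⟨!![1, s; 0, 1], by simp⟩

def lower (s : F) : SL(2, F) := ⟨!![1, 0; s, 1], by simp⟩

theorem upper_apply (s : F) : upper s 0 0 = 1 ∧ upper s 0 1 = s ∧ upper s 1 0 = 0 ∧
    upper s 1 1 = 1 := ⟨rfl, rfl, rfl, rfl⟩

theorem lower_apply (s : F) : lower s 0 0 = 1 ∧ lower s 0 1 = 0 ∧ lower s 1 0 = s ∧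
    lower s 1 1 = 1 := ⟨rfl, rfl, rfl, rfl⟩

/-- The standard Weyl element. -/
def weyl : SL(2, F) := ⟨!![0, -1; 1, 0], by simp⟩

theorem weyl_apply : (weyl : SL(2, F)) 0 0 = 0 ∧ (weyl : SL(2, F)) 0 1 = -1 ∧
    (weyl : SL(2, F)) 1 0 = 1 ∧ (weyl : SL(2, F)) 1 1 = 0 := ⟨rfl, rfl, rfl, rfl⟩

theorem upper_mul (s t : F) : upper s * upper t = upper (s + t) := by
  obtain ⟨a1, a2, a3, a4⟩ := upper_apply s
  obtain ⟨b1, b2, b3, b4⟩ := upper_apply t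
  obtain ⟨c1, c2, c3, c4⟩ := upper_apply (s + t)
  apply ext_two <;> simp only [mul_apply_two, a1, a2, a3, a4, b1, b2, b3, b4, c1, c2, c3, c4] <;>
    ring

theorem lower_mul (s t : F) : lower s * lower t = lower (s + t) := by
  obtain ⟨a1, a2, a3, a4⟩ := lower_apply s
  obtain ⟨b1, b2, b3, b4⟩ := lower_apply t
  obtain ⟨c1, c2, c3, c4⟩ := lower_apply (s + t)
  apply ext_two <;> simp only [mul_apply_two, a1, a2, a3, a4, b1, b2, b3, b4, c1, c2, c3, c4] <;>
    ring

theorem upper_pow (s : F) (n : ℕ) : upper s ^ n = upper (n * s) := by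
  induction n with
  | zero => apply ext_two <;> simp [upper_apply]
  | succ n ih => rw [pow_succ, ih, upper_mul]; congr 1; push_cast; ring

theorem lower_pow (s : F) (n : ℕ) : lower s ^ n = lower (n * s) := by
  induction n with
  | zero => apply ext_two <;> simp [lower_apply]
  | succ n ih => rw [pow_succ, ih, lower_mul]; congr 1; push_cast; ring

theorem upper_inv (s : F) : (upper s)⁻¹ = upper (-s) := by
  rw [inv_eq_iff_mul_eq_one, upper_mul]
  apply ext_two <;> simp [upper_apply]

/-- A trace `2` element with a non-zero lower left entry is conjugate to a lower unitriangular
matrix by an upper unitriangular one. -/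
theorem exists_upper_conj_eq_lower {x : SL(2, F)} (ht : x 0 0 + x 1 1 = 2) (hc : x 1 0 ≠ 0) :
    ∃ r, upper r * x * (upper r)⁻¹ = lower (x 1 0) := by
  refine ⟨(1 - x 0 0) / x 1 0, ?_⟩
  have hd := det_two x
  set r := (1 - x 0 0) / x 1 0 with hr
  have hr' : r * x 1 0 = 1 - x 0 0 := by rw [hr]; field_simp
  clear_value r
  rw [upper_inv]
  obtain ⟨a1, a2, a3, a4⟩ := upper_apply r
  obtain ⟨b1, b2, b3, b4⟩ := upper_apply (-r)
  obtain ⟨c1, c2, c3, c4⟩ := lower_apply (x 1 0)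
  apply ext_two <;> simp only [mul_apply_two, a1, a2, a3, a4, b1, b2, b3, b4, c1, c2, c3, c4]
  · linear_combination hr'
  · apply mul_left_cancel₀ hc
    linear_combination (x 1 1 - 1 - r * x 1 0) * hr' + ht - hd
  · ring
  · linear_combination ht - hr'

theorem exists_conj_eq_upper {x : SL(2, F)} (ht : x 0 0 + x 1 1 = 2) (hx : x ≠ 1) :
    ∃ g s, s ≠ 0 ∧ g * x * g⁻¹ = upper s := by
  by_cases hc : x 1 0 = 0
  · have hd := det_two x
    have h1 : (x 0 0 - 1) ^ 2 = 0 := by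
      rw [hc] at hd
      linear_combination x 0 0 * ht - hd
    have h0 : x 0 0 = 1 := by
      rw [sq_eq_zero_iff] at h1; linear_combination h1
    have h3 : x 1 1 = 1 := by linear_combination ht - h0
    have hxu : x = upper (x 0 1) := ext_two h0 rfl hc h3
    refine ⟨1, x 0 1, fun h => hx ?_, by simpa using hxu⟩
    rw [hxu, h]
    apply ext_two <;> simp [upper_apply]
  · obtain ⟨r, hr⟩ := exists_upper_conj_eq_lower ht hc
    refine ⟨weyl * upper r, -x 1 0, by simpa using hc, ?_⟩
    have hr' : upper r * x = lower (x 1 0) * upper r := mul_inv_eq_iff_eq_mul.1 hr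
    have hw : weyl * lower (x 1 0) = upper (-x 1 0) * weyl := by
      apply ext_two <;> simp [mul_apply_two, upper_apply, lower_apply, weyl_apply]
    refine mul_inv_eq_iff_eq_mul.2 ?_
    rw [mul_assoc, hr', ← mul_assoc, hw, mul_assoc]

theorem eq_top_of_upper_lower_mem {K : Subgroup SL(2, F)} (hu : ∀ s, upper s ∈ K)
    (hl : ∀ s, lower s ∈ K) : K = ⊤ := by
  have h1 : ∀ g : SL(2, F), g 1 0 ≠ 0 → g ∈ K := fun g hg => by
    have : g = upper ((g 0 0 - 1) / g 1 0) * lower (g 1 0) * upper ((g 1 1 - 1) / g 1 0) := by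
      have hd := det_two g
      apply ext_two <;> simp [mul_apply_two, upper_apply, lower_apply] <;> field_simp
      · ring
      · linear_combination -hd
      · ring
    rw [this]
    exact K.mul_mem (K.mul_mem (hu _) (hl _)) (hu _)
  rw [eq_top_iff]
  intro g _
  by_cases hg : g 1 0 = 0
  · have hd := det_two g
    have : lower 1 * g ∈ K := h1 _ (by
      intro h
      simp only [mul_apply_two, lower_apply, hg] at h
      have h0 : g 0 0 = 0 := by linear_combination h
      rw [h0, hg] at hd
      simp at hd)
    exact (K.mul_mem_cancel_left (hl 1)).1 this
  · exact h1 g hg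

end Field

section ZMod

variable {p : ℕ} [Fact p.Prime]

theorem upper_mem_of_upper_mem {K : Subgroup SL(2, ZMod p)} {s : ZMod p} (hs : s ≠ 0)
    (h : upper s ∈ K) (t : ZMod p) : upper t ∈ K := by
  have := K.pow_mem h (t / s).val
  rwa [upper_pow, ZMod.natCast_zmod_val, div_mul_cancel₀ _ hs] at this

theorem lower_mem_of_lower_mem {K : Subgroup SL(2, ZMod p)} {s : ZMod p} (hs : s ≠ 0)
    (h : lower s ∈ K) (t : ZMod p) : lower t ∈ K := by
  have := K.pow_mem h (t / s).val
  rwa [lower_pow, ZMod.natCast_zmod_val, div_mul_cancel₀ _ hs] at this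

/-- Two non-commuting unipotent elements generate `SL₂(𝔽_p)`. -/
theorem eq_top_of_unipotent_mem {K : Subgroup SL(2, ZMod p)} {x y : SL(2, ZMod p)}
    (hx : x ∈ K) (hy : y ∈ K) (htx : x 0 0 + x 1 1 = 2) (hty : y 0 0 + y 1 1 = 2)
    (hxy : ¬ Commute x y) : K = ⊤ := by
  obtain ⟨g, s, hs, hg⟩ := exists_conj_eq_upper htx (by rintro rfl; exact hxy (Commute.one_left _))
  set L := K.map (MulAut.conj g).toMonoidHom with hL
  have hmem : ∀ z ∈ K, g * z * g⁻¹ ∈ L := fun z hz => ⟨z, hz, rfl⟩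
  have hu := upper_mem_of_upper_mem hs (hg ▸ hmem x hx)
  have hc : (g * y * g⁻¹) 1 0 ≠ 0 := by
    intro hc
    have ht := (trace_conj g y).trans hty
    have hd := det_two (g * y * g⁻¹)
    refine hxy ((Commute.conj_iff g).1 ?_)
    rw [hg, commute_iff_apply]
    set w := g * y * g⁻¹
    have h1 : w 0 0 - w 1 1 = 0 := by
      rw [hc] at hd
      rw [← sq_eq_zero_iff]
      linear_combination (w 0 0 + w 1 1 + 2) * ht - 4 * hd
    simp [upper_apply, hc, h1]
  obtain ⟨r, hr⟩ := exists_upper_conj_eq_lower ((trace_conj g y).trans hty) hc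
  have hl := lower_mem_of_lower_mem hc
    (hr ▸ L.mul_mem (L.mul_mem (hu r) (hmem y hy)) (L.inv_mem (hu r)))
  have hLt := eq_top_of_upper_lower_mem hu hl
  rw [eq_top_iff]
  intro z _
  obtain ⟨z', hz', he⟩ : g * z * g⁻¹ ∈ L := hLt ▸ Subgroup.mem_top _
  have : z' = z := by simpa using he
  exact this ▸ hz'

theorem trace_eq_two_of_orderOf_eq {x : SL(2, ZMod p)} (hx : orderOf x = p) :
    x 0 0 + x 1 1 = 2 := by
  have h1 : (x : Matrix (Fin 2) (Fin 2) (ZMod p)) ^ p = 1 := by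
    have h0 : x ^ p = 1 := orderOf_dvd_iff_pow_eq_one.1 hx.dvd
    rw [← coe_pow, h0, coe_one]
  have h2 : ((x : Matrix (Fin 2) (Fin 2) (ZMod p)) - 1) ^ p = 0 := by
    rw [sub_pow_char_of_commute p (Commute.one_right _), h1, one_pow, sub_self]
  have h3 := (Matrix.isNilpotent_trace_of_isNilpotent ⟨p, h2⟩).eq_zero
  rw [Matrix.trace_fin_two] at h3
  simp at h3
  linear_combination h3

theorem orderOf_eq_of_trace_eq_two {x : SL(2, ZMod p)} (ht : x 0 0 + x 1 1 = 2) (hx : x ≠ 1) :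
    orderOf x = p := by
  obtain ⟨g, s, hs, hg⟩ := exists_conj_eq_upper ht hx
  refine orderOf_eq_prime ?_ hx
  have h : g * x ^ p * g⁻¹ = 1 := by
    rw [← conj_pow, hg, upper_pow]
    apply ext_two <;> simp [upper_apply]
  simpa using h

end ZMod

end Matrix.SpecialLinearGroup

/-- Generators of a binary tetrahedral group. -/
structure IsTetrahedralTriple {G : Type*} [Group G] [HasDistribNeg G] (i j w : G) : Prop where
  ii : i * i = -1
  jj : j * j = -1
  ji : j * i = -(i * j)
  wi : w * i = j * w
  wj : w * j = i * j * w
  www : w * (w * w) = -1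
  neg_ne : ∀ x : G, -x ≠ x

namespace IsTetrahedralTriple

variable {G : Type*} [Group G] [HasDistribNeg G] {i j w : G} (h : IsTetrahedralTriple i j w)
include h

theorem iix (x : G) : i * (i * x) = -x := by rw [← mul_assoc, h.ii, neg_one_mul]

theorem jix (x : G) : j * (i * x) = -(i * (j * x)) := by
  rw [← mul_assoc, h.ji, neg_mul, mul_assoc]

theorem inv_i : i⁻¹ = -i := by
  rw [inv_eq_iff_mul_eq_one, mul_neg, h.ii, neg_neg]

theorem inv_j : j⁻¹ = -j := by
  rw [inv_eq_iff_mul_eq_one, mul_neg, h.jj, neg_neg]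

/-- The quaternion group generated by `i` and `j`. -/
def quaternion : Subgroup G where
  carrier := {1, -1, i, -i, j, -j, i * j, -(i * j)}
  one_mem' := by simp
  mul_mem' := by
    rintro a b (rfl | rfl | rfl | rfl | rfl | rfl | rfl | rfl)
      (rfl | rfl | rfl | rfl | rfl | rfl | rfl | rfl) <;>
    simp [mul_assoc, h.ii, h.jj, h.ji, h.iix, h.jix]
  inv_mem' := by
    rintro a (rfl | rfl | rfl | rfl | rfl | rfl | rfl | rfl) <;>
    simp [h.ji, h.inv_i, h.inv_j, inv_neg]

theorem mem_quaternion {x : G} : x ∈ h.quaternion ↔ x = 1 ∨ x = -1 ∨ x = i ∨ x = -i ∨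
    x = j ∨ x = -j ∨ x = i * j ∨ x = -(i * j) := Iff.rfl

theorem i_mem : i ∈ h.quaternion := h.mem_quaternion.2 (by simp)

theorem j_mem : j ∈ h.quaternion := h.mem_quaternion.2 (by simp)

theorem not_commute : ¬ Commute i j := fun hc => h.neg_ne (i * j) (by rw [← h.ji]; exact hc.eq.symm)

theorem card_quaternion : Nat.card h.quaternion = 8 := by
  classical
  have hi : i ≠ 1 ∧ i ≠ -1 := by
    constructor <;> intro hi <;> have := h.ii <;> rw [hi] at this <;>
      exact h.neg_ne 1 (by simpa using this.symm)
  have hj : j ≠ 1 ∧ j ≠ -1 := by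
    constructor <;> intro hj <;> have := h.jj <;> rw [hj] at this <;>
      exact h.neg_ne 1 (by simpa using this.symm)
  have hij : i ≠ j ∧ i ≠ -j := by
    constructor <;> intro hi <;> apply h.not_commute <;> rw [hi]
    exact (Commute.refl j).neg_left
  have hk : i * j ≠ 1 ∧ i * j ≠ -1 := by
    constructor <;> intro hk
    · exact hij.2 (by rw [← h.inv_j]; exact eq_inv_of_mul_eq_one_left hk)
    · exact hij.1 (by rw [← neg_eq_iff_eq_neg, ← mul_neg] at hk
                      have := eq_inv_of_mul_eq_one_left hk
                      rwa [inv_neg, h.inv_j, neg_neg] at this)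
  have hik : i ≠ i * j ∧ i ≠ -(i * j) := by
    constructor <;> intro hk
    · exact hj.1 (by simpa using hk)
    · rw [← mul_neg] at hk
      exact hj.2 (neg_eq_iff_eq_neg.1 (left_eq_mul.1 hk))
  have hjk : j ≠ i * j ∧ j ≠ -(i * j) := by
    constructor <;> intro hk
    · exact hi.1 (by simpa using hk)
    · rw [← neg_mul] at hk
      exact hi.2 (neg_eq_iff_eq_neg.1 (right_eq_mul.1 hk))
  have hcoe : (h.quaternion : Set G) =
      (({1, -1, i, -i, j, -j, i * j, -(i * j)} : Finset G) : Set G) := by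
    ext x; simp [h.mem_quaternion]
  have h1 : Nat.card h.quaternion = (h.quaternion : Set G).ncard := rfl
  have hn := h.neg_ne
  have hn' : ∀ x : G, x ≠ -x := fun x => (h.neg_ne x).symm
  rw [h1, hcoe, Set.ncard_coe_finset]
  have e : ∀ x y : G, (-x = y ↔ x = -y) := fun x y => neg_eq_iff_eq_neg
  have one_ne_neg : ∀ {x : G}, x ≠ -1 → 1 ≠ -x := fun hx h' => hx (by rw [h', neg_neg])
  rw [Finset.card_insert_of_notMem, Finset.card_insert_of_notMem, Finset.card_insert_of_notMem,
    Finset.card_insert_of_notMem, Finset.card_insert_of_notMem, Finset.card_insert_of_notMem,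
    Finset.card_insert_of_notMem, Finset.card_singleton]
  all_goals simp only [Finset.mem_insert, Finset.mem_singleton, not_or, e, neg_neg]
  · exact hn' _
  · exact ⟨hjk.2, hjk.1⟩
  · exact ⟨hn' _, hjk⟩
  · exact ⟨hij.2, hij.1, hik.2, hik.1⟩
  · exact ⟨hn' _, hij.1, hij.2, hik⟩
  · exact ⟨one_ne_neg hi.2, hi.1.symm, one_ne_neg hj.2, hj.1.symm, one_ne_neg hk.2, hk.1.symm⟩
  · exact ⟨hn' _, hi.1.symm, one_ne_neg hi.2, hj.1.symm, one_ne_neg hj.2, hk.1.symm,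
      one_ne_neg hk.2⟩

theorem w_conj_i : w * i * w⁻¹ = j := by rw [h.wi, mul_inv_cancel_right]

theorem w_conj_j : w * j * w⁻¹ = i * j := by rw [h.wj, mul_inv_cancel_right]

theorem w_conj_k : w * (i * j) * w⁻¹ = i := by
  rw [← mul_assoc, h.wi, mul_assoc j, h.wj, ← mul_assoc, mul_inv_cancel_right, ← mul_assoc, h.ji,
    neg_mul, mul_assoc, h.jj, mul_neg_one, neg_neg]

theorem conj_mem {x : G} (hx : x ∈ h.quaternion) : w * x * w⁻¹ ∈ h.quaternion := by
  rw [h.mem_quaternion] at *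
  rcases hx with rfl | rfl | rfl | rfl | rfl | rfl | rfl | rfl <;>
    simp only [mul_neg, neg_mul, mul_one, mul_inv_cancel, h.w_conj_i, h.w_conj_j, h.w_conj_k] <;>
    simp

theorem w_mem_normalizer : w ∈ Subgroup.normalizer (h.quaternion : Set G) := by
  rw [Subgroup.mem_normalizer_iff]
  refine fun x => ⟨h.conj_mem, fun hx => ?_⟩
  have h3 := h.conj_mem (h.conj_mem hx)
  have e : w * (w * (w * x * w⁻¹) * w⁻¹) * w⁻¹ = (w * (w * w)) * x * (w * (w * w))⁻¹ := by group
  rw [e, h.www] at h3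
  simpa [inv_neg] using h3

theorem exists_commute_conj_of_sq_eq_neg_one {y : G} (hy : y ∈ h.quaternion) (hy2 : y * y = -1) :
    ∃ n : ℕ, Commute (w ^ n * i * (w ^ n)⁻¹) y := by
  have e1 : w ^ 1 * i * (w ^ 1)⁻¹ = j := by rw [pow_one, h.w_conj_i]
  have e2 : w ^ 2 * i * (w ^ 2)⁻¹ = i * j := by
    rw [sq, mul_inv_rev, ← h.w_conj_j, ← h.w_conj_i]; group
  rcases h.mem_quaternion.1 hy with rfl | rfl | rfl | rfl | rfl | rfl | rfl | rfl
  · exact absurd hy2 (by simpa using (h.neg_ne 1).symm)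
  · exact absurd hy2 (by simpa using (h.neg_ne 1).symm)
  · exact ⟨0, by simp⟩
  · exact ⟨0, by simp⟩
  · exact ⟨1, by rw [e1]⟩
  · exact ⟨1, by rw [e1]; exact (Commute.refl _).neg_right⟩
  · exact ⟨2, by rw [e2]⟩
  · exact ⟨2, by rw [e2]; exact (Commute.refl _).neg_right⟩

/-- The binary tetrahedral group generated by `i`, `j` and `w`. -/
def binaryTetrahedral : Subgroup G := h.quaternion ⊔ Subgroup.zpowers w

theorem binaryTetrahedral_le {K : Subgroup G} (hi : i ∈ K) (hj : j ∈ K) (hw : w ∈ K) :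
    h.binaryTetrahedral ≤ K := by
  have hn : -1 ∈ K := h.ii ▸ K.mul_mem hi hi
  refine sup_le (fun x hx => ?_) ((Subgroup.zpowers_le).2 hw)
  have hneg : ∀ x ∈ K, -x ∈ K := fun x hx => by
    rw [← neg_one_mul]; exact K.mul_mem hn hx
  rcases h.mem_quaternion.1 hx with rfl | rfl | rfl | rfl | rfl | rfl | rfl | rfl
  · exact K.one_mem
  · exact hn
  · exact hi
  · exact hneg _ hi
  · exact hj
  · exact hneg _ hj
  · exact K.mul_mem hi hj
  · exact hneg _ (K.mul_mem hi hj)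

theorem zpowers_le_binaryTetrahedral : Subgroup.zpowers w ≤ h.binaryTetrahedral := le_sup_right

theorem quaternion_le_binaryTetrahedral : h.quaternion ≤ h.binaryTetrahedral := le_sup_left

theorem w_mem : w ∈ h.binaryTetrahedral :=
  h.zpowers_le_binaryTetrahedral (Subgroup.mem_zpowers w)

open scoped Pointwise in
theorem coe_binaryTetrahedral : (h.binaryTetrahedral : Set G) =
    (h.quaternion : Set G) * (Subgroup.zpowers w : Set G) :=
  Subgroup.coe_mul_of_right_le_normalizer_left _ _ ((Subgroup.zpowers_le).2 h.w_mem_normalizer)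

theorem w_pow_six : w ^ 6 = 1 := by
  have : w ^ 6 = (w * (w * w)) * (w * (w * w)) := by
    simp only [pow_succ, pow_zero, one_mul, mul_assoc]
  rw [this, h.www, neg_one_mul, neg_neg]

theorem orderOf_w_dvd : orderOf w ∣ 6 := orderOf_dvd_of_pow_eq_one h.w_pow_six

open scoped Pointwise in
theorem card_binaryTetrahedral_le : Nat.card h.binaryTetrahedral ≤ 48 := by
  have h1 : Nat.card h.binaryTetrahedral =
    Nat.card ((h.quaternion : Set G) * (Subgroup.zpowers w : Set G) : Set G) := by
    rw [← h.coe_binaryTetrahedral]; rfl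
  rw [h1]
  refine Set.natCard_mul_le.trans ?_
  have h2 : Nat.card (h.quaternion : Set G) = 8 := h.card_quaternion
  have h3 : Nat.card (Subgroup.zpowers w : Set G) = orderOf w := Nat.card_zpowers w
  rw [h2, h3]
  have := Nat.le_of_dvd (by norm_num) h.orderOf_w_dvd
  omega

theorem i_notMem_zpowers : i ∉ Subgroup.zpowers w := by
  intro hi
  obtain ⟨n, hn⟩ := Subgroup.mem_zpowers_iff.1 hi
  have hc : Commute w i := hn ▸ (Commute.refl w).zpow_right n
  have hij : i = j := by
    have := h.wi
    rw [hc.eq] at this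
    exact mul_right_cancel this
  exact h.not_commute (hij ▸ Commute.refl i)

theorem neg_one_mem_zpowers : -1 ∈ Subgroup.zpowers w := by
  rw [← h.www]
  have := Subgroup.mem_zpowers w
  exact mul_mem this (mul_mem this this)

theorem zpowers_covBy_binaryTetrahedral : Subgroup.zpowers w ⋖ h.binaryTetrahedral := by
  refine ⟨lt_of_le_of_ne h.zpowers_le_binaryTetrahedral fun he => h.i_notMem_zpowers ?_, ?_⟩
  · rw [he]; exact h.quaternion_le_binaryTetrahedral h.i_mem
  intro K hK1 hK2
  have hw : w ∈ K := hK1.le (Subgroup.mem_zpowers w)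
  have hn : -1 ∈ K := hK1.le h.neg_one_mem_zpowers
  obtain ⟨g, hgK, hg⟩ := SetLike.exists_of_lt hK1
  have hgT : g ∈ (h.binaryTetrahedral : Set G) := hK2.le hgK
  rw [h.coe_binaryTetrahedral] at hgT
  obtain ⟨q, hq, v, hv, rfl⟩ := Set.mem_mul.1 hgT
  have hqK : q ∈ K := (K.mul_mem_cancel_right (hK1.le hv)).1 hgK
  have hqw : q ∉ Subgroup.zpowers w := fun h' => hg (mul_mem h' hv)
  have hneg : ∀ x, -x ∈ K → x ∈ K := fun x hx => by
    have := K.mul_mem hn hx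
    simpa using this
  have hconj : ∀ x ∈ K, w * x * w⁻¹ ∈ K := fun x hx => K.mul_mem (K.mul_mem hw hx) (K.inv_mem hw)
  have hone : i ∈ K ∨ j ∈ K ∨ i * j ∈ K := by
    rcases h.mem_quaternion.1 hq with rfl | rfl | rfl | rfl | rfl | rfl | rfl | rfl
    · exact absurd (one_mem _) hqw
    · exact absurd h.neg_one_mem_zpowers hqw
    · exact Or.inl hqK
    · exact Or.inl (hneg _ hqK)
    · exact Or.inr (Or.inl hqK)
    · exact Or.inr (Or.inl (hneg _ hqK))
    · exact Or.inr (Or.inr hqK)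
    · exact Or.inr (Or.inr (hneg _ hqK))
  have hi : i ∈ K := by
    rcases hone with h' | h' | h'
    · exact h'
    · have := hconj _ h'
      rw [h.w_conj_j] at this
      have := hconj _ this
      rwa [h.w_conj_k] at this
    · have := hconj _ h'
      rwa [h.w_conj_k] at this
  have hj : j ∈ K := by
    have := hconj _ hi
    rwa [h.w_conj_i] at this
  exact hK2.not_ge (h.binaryTetrahedral_le hi hj hw)

theorem covBy_zpowers [Finite G] {Z : Subgroup G} (hZ : ∀ x, x ∈ Z ↔ x = 1 ∨ x = -1) :
    Z ⋖ Subgroup.zpowers w := by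
  have hZw : Z ≤ Subgroup.zpowers w := fun x hx => by
    rcases (hZ x).1 hx with rfl | rfl
    · exact one_mem _
    · exact h.neg_one_mem_zpowers
  have hZ2 : Nat.card Z = 2 := by
    have h1 : (Z : Set G) = {1, -1} := by ext x; simp [hZ]
    have h2 : Nat.card Z = (Z : Set G).ncard := rfl
    rw [h2, h1, Set.ncard_pair (h.neg_ne 1).symm]
  refine ⟨lt_of_le_of_ne hZw fun he => ?_, ?_⟩
  · have hw : w ∈ Z := he ▸ Subgroup.mem_zpowers w
    have hc : Commute w i := by
      rcases (hZ w).1 hw with h' | h' <;> rw [h']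
      · exact Commute.one_left _
      · exact (Commute.one_left _).neg_left
    have hij : i = j := by
      have := h.wi
      rw [hc.eq] at this
      exact mul_right_cancel this
    exact h.not_commute (hij ▸ Commute.refl i)
  · intro K h1 h2
    have d1 : 2 ∣ Nat.card K := hZ2 ▸ Subgroup.card_dvd_of_le h1.le
    have d2 : Nat.card K ∣ Nat.card (Subgroup.zpowers w) := Subgroup.card_dvd_of_le h2.le
    have d3 : Nat.card (Subgroup.zpowers w) ∣ 6 := by
      rw [Nat.card_zpowers]; exact h.orderOf_w_dvd
    have n1 : Nat.card K ≠ 2 := fun hk =>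
      h1.ne (Subgroup.eq_of_le_of_card_ge h1.le (by rw [hk, hZ2]))
    have n2 : Nat.card K ≠ 6 := fun hk =>
      h2.ne (Subgroup.eq_of_le_of_card_ge h2.le (by
        rw [hk]; exact Nat.le_of_dvd (by norm_num) d3))
    have l6 := Nat.le_of_dvd (by norm_num) (d2.trans d3)
    have d6 := d2.trans d3
    obtain ⟨c, hc⟩ := d1
    have : Nat.card K = 4 ∨ Nat.card K = 0 := by omega
    rcases this with h' | h' <;> rw [h'] at d6 <;> norm_num at d6

end IsTetrahedralTriple

namespace Matrix.SpecialLinearGroup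

theorem exists_isTetrahedralTriple {p : ℕ} [Fact p.Prime] (h2 : (2 : ZMod p) ≠ 0) :
    ∃ i j w : SL(2, ZMod p), IsTetrahedralTriple i j w := by
  obtain ⟨a, b, hab⟩ := ZMod.sq_add_sq p (-1)
  have hj : (!![a, b; b, -a] : Matrix (Fin 2) (Fin 2) (ZMod p)).det = 1 := by
    rw [Matrix.det_fin_two_of]; linear_combination -hab
  have hw : (!![(1 + a - b) / 2, (-1 + a + b) / 2; (1 + a + b) / 2, (1 - a + b) / 2] :
      Matrix (Fin 2) (Fin 2) (ZMod p)).det = 1 := by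
    rw [Matrix.det_fin_two_of]
    field_simp
    linear_combination (-2 : ZMod p) * hab
  set j : SL(2, ZMod p) := ⟨_, hj⟩ with hjdef
  set w : SL(2, ZMod p) := ⟨_, hw⟩ with hwdef
  have jA : j 0 0 = a ∧ j 0 1 = b ∧ j 1 0 = b ∧ j 1 1 = -a := ⟨rfl, rfl, rfl, rfl⟩
  have wA : w 0 0 = (1 + a - b) / 2 ∧ w 0 1 = (-1 + a + b) / 2 ∧ w 1 0 = (1 + a + b) / 2 ∧
    w 1 1 = (1 - a + b) / 2 := ⟨rfl, rfl, rfl, rfl⟩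
  clear_value j w
  obtain ⟨j1, j2, j3, j4⟩ := jA
  obtain ⟨w1, w2, w3, w4⟩ := wA
  have neg_apply : ∀ (x : SL(2, ZMod p)) (r s : Fin 2), (-x) r s = -(x r s) := fun x r s => rfl
  have one_apply : (1 : SL(2, ZMod p)) 0 0 = 1 ∧ (1 : SL(2, ZMod p)) 0 1 = 0 ∧
    (1 : SL(2, ZMod p)) 1 0 = 0 ∧ (1 : SL(2, ZMod p)) 1 1 = 1 := ⟨rfl, rfl, rfl, rfl⟩
  obtain ⟨o1, o2, o3, o4⟩ := one_apply
  obtain ⟨i1, i2, i3, i4⟩ := weyl_apply (F := ZMod p)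
  refine ⟨weyl, j, w, ?_, ?_, ?_, ?_, ?_, ?_, ?_⟩
  · apply ext_two <;> simp only [mul_apply_two, neg_apply, o1, o2, o3, o4, i1, i2, i3, i4] <;> ring
  · apply ext_two <;> simp only [mul_apply_two, neg_apply, o1, o2, o3, o4, j1, j2, j3, j4] <;>
      first | ring1 | linear_combination hab
  · apply ext_two <;>
      simp only [mul_apply_two, neg_apply, i1, i2, i3, i4, j1, j2, j3, j4] <;> ring
  · apply ext_two <;>
      simp only [mul_apply_two, i1, i2, i3, i4, j1, j2, j3, j4, w1, w2, w3, w4] <;> field_simp <;>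
      first | ring1 | linear_combination hab | linear_combination -hab
  · apply ext_two <;>
      simp only [mul_apply_two, i1, i2, i3, i4, j1, j2, j3, j4, w1, w2, w3, w4] <;> field_simp <;>
      ring1
  · apply ext_two <;>
      simp only [mul_apply_two, neg_apply, o1, o2, o3, o4, w1, w2, w3, w4] <;> field_simp
    · linear_combination (6 + 2 * a - 2 * b) * hab
    · linear_combination (-2 + 2 * a + 2 * b) * hab
    · linear_combination (2 + 2 * a + 2 * b) * hab
    · linear_combination (6 - 2 * a + 2 * b) * hab
  · intro x hx
    have h0 : ∀ r s, x r s = 0 := fun r s => by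
      have := congrArg (fun y : SL(2, ZMod p) => y r s) hx
      simp only [neg_apply] at this
      apply (mul_eq_zero.1 (_ : 2 * x r s = 0)).resolve_left h2
      linear_combination -this
    have := det_two x
    simp [h0] at this

theorem card_mul_card_units (p : ℕ) [Fact p.Prime] :
    Nat.card SL(2, ZMod p) * (p - 1) = (p ^ 2 - 1) * (p ^ 2 - p) := by
  have h1 := Matrix.card_GL_field (𝔽 := ZMod p) 2
  rw [Fin.prod_univ_two] at h1
  simp only [ZMod.card, Fin.val_zero, Fin.val_one, pow_zero, pow_one] at h1
  rw [← h1]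
  set d : GL (Fin 2) (ZMod p) →* (ZMod p)ˣ := GeneralLinearGroup.det
  have hsurj : Function.Surjective d := fun u => by
    refine ⟨GeneralLinearGroup.mkOfDetNeZero !![(u : ZMod p), 0; 0, 1] (by simp), ?_⟩
    ext
    simp [d, GeneralLinearGroup.mkOfDetNeZero]
  have hker : Nat.card d.ker = Nat.card SL(2, ZMod p) := by
    refine Nat.card_congr ⟨fun g => ⟨(g : GL (Fin 2) (ZMod p)), ?_⟩, fun g => ⟨toGL g, ?_⟩, ?_, ?_⟩
    · have := congrArg (Units.val) (MonoidHom.mem_ker.1 g.2)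
      simpa [d] using this
    · rw [MonoidHom.mem_ker]
      ext
      simp [d]
    · intro g; ext; rfl
    · intro g; ext; rfl
  have hidx : d.ker.index = p - 1 := by
    rw [Subgroup.index_ker, MonoidHom.range_eq_top.2 hsurj, Subgroup.card_top,
      Nat.card_eq_fintype_card, ZMod.card_units p]
  rw [← hker, ← hidx]
  exact Subgroup.card_mul_index _

theorem card_eq (p : ℕ) [Fact p.Prime] : Nat.card SL(2, ZMod p) = p * (p ^ 2 - 1) := by
  have hp := (Fact.out : p.Prime).two_le
  have h := card_mul_card_units p
  have h1 : p ^ 2 - p = p * (p - 1) := by rw [Nat.mul_sub, mul_one, sq]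
  rw [h1] at h
  refine Nat.eq_of_mul_eq_mul_right (by omega : 0 < p - 1) (h.trans ?_)
  ring

section Tetrahedral

variable {p : ℕ} [Fact p.Prime] {i j w : SL(2, ZMod p)}

/-- A subgroup of order divisible by `p` that does not fix a line is everything. -/
theorem eq_top_of_dvd_card (h : IsTetrahedralTriple i j w) (h2 : (2 : ZMod p) ≠ 0)
    {K : Subgroup SL(2, ZMod p)} (hi : i ∈ K) (hj : j ∈ K) (hp : p ∣ Nat.card K) : K = ⊤ := by
  obtain ⟨⟨x, hxK⟩, hx⟩ := exists_prime_orderOf_dvd_card' p hp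
  rw [Subgroup.orderOf_mk] at hx
  have ht := trace_eq_two_of_orderOf_eq hx
  have hx1 : x ≠ 1 := by
    rintro rfl
    rw [orderOf_one] at hx
    exact (Fact.out : p.Prime).one_lt.ne hx
  have hconj : ∀ g ∈ K, Commute x (g * x * g⁻¹) ∨ K = ⊤ := fun g hg => by
    by_cases hc : Commute x (g * x * g⁻¹)
    · exact Or.inl hc
    · exact Or.inr (eq_top_of_unipotent_mem hxK (K.mul_mem (K.mul_mem hg hxK) (K.inv_mem hg)) ht
        ((trace_conj g x).trans ht) hc)
  rcases hconj i hi with hci | h' <;> [skip; exact h']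
  rcases hconj j hj with hcj | h' <;> [skip; exact h']
  exfalso
  obtain ⟨g, s, hs, hg⟩ := exists_conj_eq_upper ht hx1
  have key : ∀ c, Commute x (c * x * c⁻¹) → (g * c * g⁻¹) 1 0 = 0 := fun c hc => by
    have h1 := (Commute.conj_iff g).2 hc
    have h2 : g * (c * x * c⁻¹) * g⁻¹ =
        (g * c * g⁻¹) * (g * x * g⁻¹) * (g * c * g⁻¹)⁻¹ := by group
    rw [h2, hg] at h1
    set d := g * c * g⁻¹
    obtain ⟨e, -, -⟩ := (commute_iff_apply _ _).1 h1
    obtain ⟨i1, i2, i3, i4⟩ := inv_apply_two d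
    obtain ⟨u1, u2, u3, u4⟩ := upper_apply s
    simp only [mul_apply_two, i1, i2, i3, i4, u1, u2, u3, u4] at e
    have : s ^ 2 * d 1 0 ^ 2 = 0 := by linear_combination -e
    simpa [hs] using this
  have ki := key i hci
  have kj := key j hcj
  have hji : (g * j * g⁻¹) * (g * i * g⁻¹) = -((g * i * g⁻¹) * (g * j * g⁻¹)) := by
    have e1 : (g * j * g⁻¹) * (g * i * g⁻¹) = g * (j * i) * g⁻¹ := by group
    have e2 : (g * i * g⁻¹) * (g * j * g⁻¹) = g * (i * j) * g⁻¹ := by group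
    rw [e1, e2, h.ji, mul_neg, neg_mul]
  set I := g * i * g⁻¹
  set J := g * j * g⁻¹
  have e := congrArg (fun y : SL(2, ZMod p) => y 0 0) hji
  have e' : J 0 0 * I 0 0 + J 0 1 * I 1 0 = -(I 0 0 * J 0 0 + I 0 1 * J 1 0) := by
    rw [← mul_apply_two, ← mul_apply_two]; exact e
  rw [ki, kj] at e'
  have hdI := det_two I
  have hdJ := det_two J
  rw [ki] at hdI
  rw [kj] at hdJ
  have e0 : 2 * (I 0 0 * J 0 0) = 0 := by linear_combination e'
  rcases mul_eq_zero.1 ((mul_eq_zero.1 e0).resolve_left h2) with h' | h'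
  · rw [h'] at hdI; simp at hdI
  · rw [h'] at hdJ; simp at hdJ

theorem trace_sq_ne_four {K : Subgroup SL(2, ZMod p)} (hn : -1 ∈ K) (hp : ¬ p ∣ Nat.card K)
    {x : SL(2, ZMod p)} (hx : x ∈ K) (hxc : x ∉ Subgroup.center SL(2, ZMod p)) :
    (x 0 0 + x 1 1) ^ 2 ≠ 4 := by
  rw [mem_center_iff_eq_one_or_neg_one, not_or] at hxc
  have key : ∀ y ∈ K, y ≠ 1 → y 0 0 + y 1 1 ≠ 2 := fun y hy hy1 ht => hp (by
    have := orderOf_eq_of_trace_eq_two ht hy1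
    have h3 : orderOf (⟨y, hy⟩ : K) = p := by rw [Subgroup.orderOf_mk, this]
    have h4 := orderOf_dvd_natCard (⟨y, hy⟩ : K)
    rwa [h3] at h4)
  intro h
  have : (x 0 0 + x 1 1 - 2) * (x 0 0 + x 1 1 + 2) = 0 := by linear_combination h
  rcases mul_eq_zero.1 this with h' | h'
  · exact key x hx hxc.1 (by linear_combination h')
  · refine key (-x) ?_ (fun h => hxc.2 (neg_eq_iff_eq_neg.1 h)) ?_
    · rw [← neg_one_mul]; exact K.mul_mem hn hx
    · change -x 0 0 + -x 1 1 = 2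
      linear_combination -h'

end Tetrahedral

end Matrix.SpecialLinearGroup

namespace Matrix.SpecialLinearGroup

variable {p : ℕ} [Fact p.Prime] {i j w : SL(2, ZMod p)}

theorem coe_mem_center_iff (h : IsTetrahedralTriple i j w)
    {K : Subgroup SL(2, ZMod p)} (hi : i ∈ K) (hj : j ∈ K) (z : K) :
    z ∈ Subgroup.center K ↔ (z : SL(2, ZMod p)) ∈ Subgroup.center SL(2, ZMod p) := by
  constructor
  · intro hz
    by_contra hc
    have hcomm : ∀ y ∈ K, Commute y (z : SL(2, ZMod p)) := fun y hy =>
      congrArg Subtype.val (Subgroup.mem_center_iff.1 hz ⟨y, hy⟩)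
    exact h.not_commute (commute_trans_of_notMem_center hc (hcomm i hi) (hcomm j hj).symm)
  · intro hz
    exact Subgroup.mem_center_iff.2 fun g => Subtype.ext (Subgroup.mem_center_iff.1 hz g)

theorem card_center_subgroup (h : IsTetrahedralTriple i j w)
    {K : Subgroup SL(2, ZMod p)} (hi : i ∈ K) (hj : j ∈ K) :
    Nat.card (Subgroup.center K) = 2 := by
  have hn : -1 ∈ K := h.ii ▸ K.mul_mem hi hi
  have h1 : (Subgroup.center K : Set K) = {1, ⟨-1, hn⟩} := by
    ext z
    rw [SetLike.mem_coe, coe_mem_center_iff h hi hj, mem_center_iff_eq_one_or_neg_one,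
      Set.mem_insert_iff, Set.mem_singleton_iff, Subtype.ext_iff, Subtype.ext_iff]
    rfl
  have h2 : Nat.card (Subgroup.center K) = (Subgroup.center K : Set K).ncard := rfl
  rw [h2, h1, Set.ncard_pair]
  intro he
  exact h.neg_ne 1 (congrArg Subtype.val he).symm

/-- An element of order `4` in a subgroup with quaternion Sylow `2`-subgroup commutes with a
conjugate of `i`. -/
theorem exists_commute_conj_of_sq (h : IsTetrahedralTriple i j w) {K : Subgroup SL(2, ZMod p)}
    (hi : i ∈ K) (hj : j ∈ K) (hw : w ∈ K) (h16 : ¬ 16 ∣ Nat.card K) {y : K}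
    (hy : (y : SL(2, ZMod p)) * y = -1) :
    ∃ g : K, Commute (g * ⟨i, hi⟩ * g⁻¹) y := by
  have hQK : h.quaternion ≤ K :=
    h.quaternion_le_binaryTetrahedral.trans (h.binaryTetrahedral_le hi hj hw)
  set Q : Subgroup K := h.quaternion.subgroupOf K
  have hQ8 : Nat.card Q = 8 := by
    rw [Nat.card_congr (Subgroup.subgroupOfEquivOfLe hQK).toEquiv, h.card_quaternion]
  have h8 : 2 ^ 3 ∣ Nat.card K := by
    have := Subgroup.card_subgroup_dvd_card Q
    rwa [hQ8] at this
  have hfac : (Nat.card K).factorization 2 = 3 := by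
    have hle := (Nat.prime_two.pow_dvd_iff_le_factorization Nat.card_pos.ne').1 h8
    by_contra hne
    exact h16 ((Nat.prime_two.pow_dvd_iff_le_factorization (k := 4) Nat.card_pos.ne').2 (by omega))
  have : Fact (Nat.Prime 2) := ⟨Nat.prime_two⟩
  set P : Sylow 2 K := Sylow.ofCard Q (by rw [hQ8, hfac]; norm_num)
  have hPQ : (P : Subgroup K) = Q := Sylow.coe_ofCard Q _
  have hy4 : y ^ (2 ^ 2) = 1 := by
    apply Subtype.ext
    have e : (y : SL(2, ZMod p)) ^ (2 ^ 2) = ((y : SL(2, ZMod p)) * y) * (y * y) := by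
      rw [show 2 ^ 2 = 2 * 2 from rfl, pow_mul, sq, sq]
    rw [Subgroup.coe_pow, e, hy, neg_one_mul, neg_neg, Subgroup.coe_one]
  have hyP : IsPGroup 2 (Subgroup.zpowers y) := by
    obtain ⟨k, -, hk⟩ := (Nat.dvd_prime_pow Nat.prime_two).1 (orderOf_dvd_of_pow_eq_one hy4)
    exact IsPGroup.of_card (by rw [Nat.card_zpowers, hk])
  obtain ⟨R, hR⟩ := hyP.exists_le_sylow
  obtain ⟨g, hg⟩ := MulAction.exists_smul_eq K R P
  have hgy : g * y * g⁻¹ ∈ Q := by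
    rw [← hPQ, ← hg]
    exact ⟨y, hR (Subgroup.mem_zpowers y), rfl⟩
  have hgyQ : (g : SL(2, ZMod p)) * y * (g : SL(2, ZMod p))⁻¹ ∈ h.quaternion :=
    Subgroup.mem_subgroupOf.1 hgy
  obtain ⟨n, hn⟩ := h.exists_commute_conj_of_sq_eq_neg_one hgyQ (by
    have e : (g : SL(2, ZMod p)) * y * (g : SL(2, ZMod p))⁻¹ *
      ((g : SL(2, ZMod p)) * y * (g : SL(2, ZMod p))⁻¹) =
        g * (y * y) * (g : SL(2, ZMod p))⁻¹ := by group
    rw [e, hy, mul_neg_one, neg_mul, mul_inv_cancel])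
  refine ⟨g⁻¹ * ⟨w, hw⟩ ^ n, (Commute.conj_iff g).1 ?_⟩
  apply Subtype.ext
  have e : (g : SL(2, ZMod p)) * ((g : SL(2, ZMod p))⁻¹ * w ^ n * i *
      ((g : SL(2, ZMod p))⁻¹ * w ^ n)⁻¹) * (g : SL(2, ZMod p))⁻¹ = w ^ n * i * (w ^ n)⁻¹ := by
    group
  have := hn.eq
  rw [← e] at this
  exact this

/-- A subgroup of order prime to `p` containing a binary tetrahedral group is that group, when the
order of `SL₂(𝔽_p)` is divisible neither by `16` nor by `5`. -/
theorem card_eq_twentyfour (h : IsTetrahedralTriple i j w) (h2 : (2 : ZMod p) ≠ 0)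
    {K : Subgroup SL(2, ZMod p)} (hi : i ∈ K) (hj : j ∈ K) (hw : w ∈ K)
    (h16 : ¬ 16 ∣ Nat.card K) (h5 : ¬ 5 ∣ Nat.card K) (hp : ¬ p ∣ Nat.card K) :
    Nat.card K = 24 := by
  have hn : -1 ∈ K := h.ii ▸ K.mul_mem hi hi
  have hcen := coe_mem_center_iff h hi hj
  have hcomm : ∀ x y z : K, y ∉ Subgroup.center K → Commute x y → Commute y z → Commute x z := by
    intro x y z hy hxy hyz
    rw [hcen] at hy
    exact Subtype.ext (commute_trans_of_notMem_center hy (congrArg Subtype.val hxy)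
      (congrArg Subtype.val hyz))
  have hinv : ∀ x g : K, x ∉ Subgroup.center K → Commute (g * x * g⁻¹) x →
      g * x * g⁻¹ = x ∨ g * x * g⁻¹ = x⁻¹ := by
    intro x g hx hc
    rw [hcen] at hx
    have := eq_or_eq_inv_of_commute h2 hx (y := (g : SL(2, ZMod p)) * x * (g : SL(2, ZMod p))⁻¹)
      (congrArg Subtype.val hc) (trace_conj _ _) (trace_sq_ne_four hn hp x.2 hx)
    exact this.imp (fun e => Subtype.ext e) (fun e => Subtype.ext e)
  set I : K := ⟨i, hi⟩ with hI
  set J : K := ⟨j, hj⟩ with hJ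
  have hIJ : ¬ Commute I J := fun hc => h.not_commute (congrArg Subtype.val hc)
  have hIc : I ∉ Subgroup.center K := fun hc =>
    hIJ (Subgroup.mem_center_iff.1 hc J).symm
  have hi2 : i ^ 2 = -1 := by rw [sq, h.ii]
  have hdvd4 : 4 ∣ Nat.card (Subgroup.centralizer ({I} : Set K)) := by
    have ho : orderOf I = 2 ^ 2 := by
      rw [hI, Subgroup.orderOf_mk]
      have : Fact (Nat.Prime 2) := ⟨Nat.prime_two⟩
      refine orderOf_eq_prime_pow ?_ ?_
      · rw [pow_one, hi2]; exact h.neg_ne 1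
      · rw [show 2 ^ (1 + 1) = 2 * 2 from rfl, pow_mul, hi2, sq, neg_one_mul, neg_neg]
    have hle : Subgroup.zpowers I ≤ Subgroup.centralizer ({I} : Set K) :=
      (Subgroup.zpowers_le).2 (Subgroup.mem_centralizer_singleton_iff.2 rfl)
    have := Subgroup.card_dvd_of_le hle
    rwa [Nat.card_zpowers, ho] at this
  have hNcard : Nat.card (Subgroup.normalizer (Subgroup.centralizer ({I} : Set K) : Set K)) =
      2 * Nat.card (Subgroup.centralizer ({I} : Set K)) := by
    refine (card_normalizer_centralizer hcomm hinv hIc).resolve_left fun he => ?_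
    have hle : Subgroup.centralizer ({I} : Set K) ≤
      Subgroup.normalizer (Subgroup.centralizer ({I} : Set K) : Set K) := Subgroup.le_normalizer
    have heq := Subgroup.eq_of_le_of_card_ge hle he.le
    have hJN : J ∈ Subgroup.normalizer (Subgroup.centralizer ({I} : Set K) : Set K) := by
      rw [mem_normalizer_centralizer_iff hcomm hIc]
      have e : J * I * J⁻¹ = I⁻¹ := by
        apply Subtype.ext
        change j * i * j⁻¹ = i⁻¹
        rw [h.ji, neg_mul, mul_inv_cancel_right, h.inv_i]
      rw [e]
      exact (Commute.refl I).inv_left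
    rw [← heq] at hJN
    exact hIJ (show Commute J I from Subgroup.mem_centralizer_singleton_iff.1 hJN).symm
  obtain ⟨m, hm⟩ := hdvd4
  have hodd : Odd m := by
    rw [← Nat.not_even_iff_odd]
    rintro ⟨k, hk⟩
    refine h16 (Dvd.dvd.trans ⟨k, ?_⟩ (Subgroup.card_subgroup_dvd_card
      (Subgroup.normalizer (Subgroup.centralizer ({I} : Set K) : Set K))))
    rw [hNcard, hm, hk]
    ring
  refine Nat.card_eq_twentyfour_of_abelian_centralizers (card_center_subgroup h hi hj) hcomm hinv
    hIc hodd hm (by rw [hNcard, hm]; ring) (fun x hx h4 => ?_) h5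
  have : Fact (Nat.Prime 2) := ⟨Nat.prime_two⟩
  obtain ⟨P, hP⟩ := Sylow.exists_subgroup_card_pow_prime 2 (n := 2)
    (G := Subgroup.centralizer ({x} : Set K)) h4
  obtain ⟨u, huP, hu⟩ : ∃ u ∈ P, ((u : K) : SL(2, ZMod p)) ∉ ({1, -1} : Set SL(2, ZMod p)) := by
    by_contra hcon
    push Not at hcon
    have h1 : ((fun u : Subgroup.centralizer ({x} : Set K) => ((u : K) : SL(2, ZMod p))) ''
        (P : Set (Subgroup.centralizer ({x} : Set K)))) ⊆ {1, -1} := by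
      rintro _ ⟨u, hu, rfl⟩
      exact hcon u hu
    have h2 := Set.ncard_le_ncard h1
    rw [Set.ncard_image_of_injective (f := fun u : Subgroup.centralizer ({x} : Set K) =>
      ((u : K) : SL(2, ZMod p))) _ (Subtype.val_injective.comp Subtype.val_injective)] at h2
    have h3 : (P : Set (Subgroup.centralizer ({x} : Set K))).ncard = 4 := hP
    have h4 := Set.ncard_pair (h.neg_ne 1).symm
    omega
  have hu4 : u ^ 4 = 1 := by
    have : (⟨u, huP⟩ : P) ^ 4 = 1 := by
      have h5 : Nat.card P = 4 := hP
      rw [← h5]; exact pow_card_eq_one'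
    exact congrArg Subtype.val this
  have hu4' : ((u : K) : SL(2, ZMod p)) ^ 4 = 1 :=
    congrArg (fun v : Subgroup.centralizer ({x} : Set K) => ((v : K) : SL(2, ZMod p))) hu4
  have husq : ((u : K) : SL(2, ZMod p)) ^ 2 = -1 := by
    have h6 : (((u : K) : SL(2, ZMod p)) ^ 2) ^ 2 = 1 := by rw [← pow_mul]; exact hu4'
    refine (eq_one_or_neg_one_of_sq_eq_one h2 h6).resolve_left fun h7 => hu ?_
    exact eq_one_or_neg_one_of_sq_eq_one h2 h7
  obtain ⟨g, hg⟩ := exists_commute_conj_of_sq h hi hj hw h16 (y := (u : K)) (by rw [← sq, husq])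
  have huc : (u : K) ∉ Subgroup.center K := by
    rw [hcen, mem_center_iff_eq_one_or_neg_one]
    exact hu
  exact ⟨g, hcomm _ _ _ huc hg (Subgroup.mem_centralizer_singleton_iff.1 u.2)⟩

theorem binaryTetrahedral_covBy_top (h : IsTetrahedralTriple i j w) (h2 : (2 : ZMod p) ≠ 0)
    (h16 : ¬ 16 ∣ Nat.card SL(2, ZMod p)) (h5 : ¬ 5 ∣ Nat.card SL(2, ZMod p))
    (hcard : 48 < Nat.card SL(2, ZMod p)) : h.binaryTetrahedral ⋖ ⊤ := by
  have key : ∀ K : Subgroup SL(2, ZMod p), h.binaryTetrahedral ≤ K → K = ⊤ ∨ Nat.card K = 24 := by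
    intro K hK
    have hi := hK (h.quaternion_le_binaryTetrahedral h.i_mem)
    have hj := hK (h.quaternion_le_binaryTetrahedral h.j_mem)
    have hd := Subgroup.card_subgroup_dvd_card K
    by_cases hp : p ∣ Nat.card K
    · exact Or.inl (eq_top_of_dvd_card h h2 hi hj hp)
    · exact Or.inr (card_eq_twentyfour h h2 hi hj (hK h.w_mem) (fun h' => h16 (h'.trans hd))
        (fun h' => h5 (h'.trans hd)) hp)
  have hne : h.binaryTetrahedral ≠ ⊤ := fun he => by
    have := h.card_binaryTetrahedral_le
    rw [he, Subgroup.card_top] at this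
    omega
  refine ⟨lt_top_iff_ne_top.2 hne, fun K h1 h2 => ?_⟩
  have hA := (key _ le_rfl).resolve_left hne
  have hK := (key K h1.le).resolve_left h2.ne
  exact h1.ne (Subgroup.eq_of_le_of_card_ge h1.le (by rw [hA, hK]))

end Matrix.SpecialLinearGroup

section Quotient

variable {G : Type*} [Group G] {N : Subgroup G} [N.Normal]

theorem Subgroup.map_mk'_lt {A B : Subgroup G} (hA : N ≤ A) (h : A < B) :
    A.map (QuotientGroup.mk' N) < B.map (QuotientGroup.mk' N) := by
  rw [← Subgroup.comap_lt_comap_of_surjective (QuotientGroup.mk'_surjective N),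
    Subgroup.comap_map_eq_self (by simpa using hA),
    Subgroup.comap_map_eq_self (by simpa using hA.trans h.le)]
  exact h

theorem Subgroup.map_mk'_covBy {A B : Subgroup G} (hA : N ≤ A) (h : A ⋖ B) :
    A.map (QuotientGroup.mk' N) ⋖ B.map (QuotientGroup.mk' N) := by
  refine ⟨Subgroup.map_mk'_lt hA h.lt, fun H h1 h2 => ?_⟩
  rw [← Subgroup.comap_lt_comap_of_surjective (QuotientGroup.mk'_surjective N),
    Subgroup.comap_map_eq_self (by simpa using hA)] at h1
  rw [← Subgroup.comap_lt_comap_of_surjective (QuotientGroup.mk'_surjective N),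
    Subgroup.comap_map_eq_self (by simpa using hA.trans h.lt.le)] at h2
  exact h.2 h1 h2

theorem Subgroup.map_mk'_top : (⊤ : Subgroup G).map (QuotientGroup.mk' N) = ⊤ :=
  Subgroup.map_top_of_surjective _ (QuotientGroup.mk'_surjective N)

/-- A chain of subgroups above a normal subgroup bounds the length of the quotient. -/
theorem le_groupLength_quotient {t : ℕ} {f : ℕ → Subgroup G} (h0 : f 0 = N) (ht : f t = ⊤)
    (hf : ∀ m < t, f m < f (m + 1)) : (t : ℕ∞) ≤ groupLength (G ⧸ N) := by
  have hN : ∀ m ≤ t, N ≤ f m := fun m => by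
    induction m with
    | zero => exact fun _ => h0.ge
    | succ m ih => exact fun hm => (ih (by omega)).trans (hf m (by omega)).le
  refine le_groupLength (c := fun k => (f (t - k)).map (QuotientGroup.mk' N)) ⟨?_, ?_, ?_⟩
  · simp only [Fin.val_zero, Nat.sub_zero, ht, Subgroup.map_mk'_top]
  · simp only [Fin.val_last, Nat.sub_self, h0, QuotientGroup.map_mk'_self]
  · intro k
    have hk := k.2
    simp only [Fin.val_succ, Fin.val_castSucc]
    have e : t - k = (t - (k + 1)) + 1 := by omega
    rw [e]
    exact Subgroup.map_mk'_lt (hN _ (by omega)) (hf _ (by omega))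

end Quotient

theorem infinite_setOfPred_prime_gt_five : (Set.ofPred fun q : ℕ => q.Prime ∧ 5 < q).Infinite :=
  Set.infinite_of_forall_exists_gt fun a => by
    obtain ⟨q, hq, hp⟩ := Nat.exists_infinite_primes (a + 6)
    exact ⟨q, ⟨hp, by omega⟩, by omega⟩

theorem primeAboveFive_spec (i : ℕ) : (primeAboveFive i).Prime ∧ 5 < primeAboveFive i :=
  Nat.nth_mem_of_infinite infinite_setOfPred_prime_gt_five i

theorem primeAboveFive_injective : Function.Injective primeAboveFive :=
  Nat.nth_injective infinite_setOfPred_prime_gt_five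

theorem coprime_primeAboveFive {i k : ℕ} (h : i ≠ k) :
    (primeAboveFive i).Coprime (primeAboveFive k) :=
  (Nat.coprime_primes (primeAboveFive_spec i).1 (primeAboveFive_spec k).1).2
    (primeAboveFive_injective.ne h)

/-- The product of the first `k` primes greater than `5`. -/
noncomputable def primorialAboveFive (k : ℕ) : ℕ := ∏ i ∈ Finset.range k, primeAboveFive i

theorem primorialAboveFive_pos (k : ℕ) : 0 < primorialAboveFive k :=
  Finset.prod_pos fun i _ => (primeAboveFive_spec i).1.pos

theorem primorialAboveFive_succ (k : ℕ) :
    primorialAboveFive (k + 1) = primorialAboveFive k * primeAboveFive k :=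
  Finset.prod_range_succ _ _

theorem coprime_primorialAboveFive {m : ℕ} (k : ℕ)
    (h : ∀ i, m.Coprime (primeAboveFive i)) : m.Coprime (primorialAboveFive k) :=
  Nat.Coprime.prod_right fun i _ => h i

theorem coprime_primeAboveFive_of_small {m i : ℕ} (hm : m ≠ 0) (h : m < 7) :
    m.Coprime (primeAboveFive i) := by
  obtain ⟨hp, h5⟩ := primeAboveFive_spec i
  have : primeAboveFive i ≠ 6 := fun h => by rw [h] at hp; norm_num at hp
  exact ((Nat.Prime.coprime_iff_not_dvd hp).2 fun hd => by
    have := Nat.le_of_dvd (by omega) hd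
    omega).symm

theorem admissiblePrimes_infinite (n : ℕ) : (admissiblePrimes n).Infinite := by
  set M := primorialAboveFive (n - 1)
  have h40 : Nat.Coprime 40 M := by
    refine coprime_primorialAboveFive _ fun i => ?_
    have h2 : Nat.Coprime 2 (primeAboveFive i) :=
      coprime_primeAboveFive_of_small (by omega) (by omega)
    have h5 : Nat.Coprime 5 (primeAboveFive i) :=
      coprime_primeAboveFive_of_small (by omega) (by omega)
    exact (h2.pow_left 3).mul_left h5
  obtain ⟨k, hk40, hkM⟩ := Nat.chineseRemainder h40 3 1
  have hcop : k.Coprime (40 * M) := by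
    refine Nat.Coprime.mul_right ?_ ?_
    · rw [Nat.Coprime, hk40.gcd_eq]; norm_num
    · rw [Nat.Coprime, hkM.gcd_eq]; norm_num
  have hM0 : 0 < M := primorialAboveFive_pos _
  refine (Nat.infinite_setOfPred_prime_and_modEq (by positivity) hcop).mono ?_
  rintro p ⟨hp, hpk⟩
  refine ⟨hp, Or.inl ?_, fun i hi => ?_⟩
  · have : p ≡ 3 [MOD 40] := (hpk.of_mul_right M).trans hk40
    exact_mod_cast (Int.natCast_modEq_iff.2 this)
  · have h1 : p ≡ 1 [MOD M] := (hpk.of_mul_left 40).trans hkM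
    exact h1.of_dvd (Finset.dvd_prod_of_mem _ (Finset.mem_range.2 hi))

section Admissible

variable {n p : ℕ}

theorem mod_forty_of_mem_admissiblePrimes (h : p ∈ admissiblePrimes n) :
    p % 40 = 3 ∨ p % 40 = 37 ∨ p % 40 = 13 ∨ p % 40 = 27 := by
  obtain ⟨-, h, -⟩ := h
  simp only [Int.ModEq] at h
  omega

theorem not_sixteen_dvd (h : p % 40 = 3 ∨ p % 40 = 37 ∨ p % 40 = 13 ∨ p % 40 = 27) :
    ¬ 16 ∣ p * (p ^ 2 - 1) := by
  intro hd
  have h1 : p * (p ^ 2 - 1) + p = p ^ 3 := by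
    have : 1 ≤ p ^ 2 := Nat.one_le_pow _ _ (by omega)
    rw [← Nat.mul_succ, Nat.succ_eq_add_one, Nat.sub_add_cancel this]; ring
  have h2 : p ^ 3 % 16 = p % 16 := by omega
  have h3 : p % 16 = 3 ∨ p % 16 = 5 ∨ p % 16 = 11 ∨ p % 16 = 13 := by omega
  rw [Nat.pow_mod] at h2
  rcases h3 with h3 | h3 | h3 | h3 <;> rw [h3] at h2 <;> omega

theorem not_five_dvd (h : p % 40 = 3 ∨ p % 40 = 37 ∨ p % 40 = 13 ∨ p % 40 = 27) :
    ¬ 5 ∣ p * (p ^ 2 - 1) := by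
  intro hd
  have h1 : p * (p ^ 2 - 1) + p = p ^ 3 := by
    have : 1 ≤ p ^ 2 := Nat.one_le_pow _ _ (by omega)
    rw [← Nat.mul_succ, Nat.succ_eq_add_one, Nat.sub_add_cancel this]; ring
  have h2 : p ^ 3 % 5 = p % 5 := by omega
  have h3 : p % 5 = 2 ∨ p % 5 = 3 := by omega
  rw [Nat.pow_mod] at h2
  rcases h3 with h3 | h3 <;> rw [h3] at h2 <;> omega

theorem two_mul_primorial_dvd (h : p ∈ admissiblePrimes n) :
    2 * primorialAboveFive (n - 1) ∣ p - 1 := by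
  have hp : 1 ≤ p := h.1.pos
  have hmod := mod_forty_of_mem_admissiblePrimes h
  refine Nat.Coprime.mul_dvd_of_dvd_of_dvd (coprime_primorialAboveFive _ fun i =>
    coprime_primeAboveFive_of_small (by omega) (by omega)) (by omega) ?_
  have key : ∀ k ≤ n - 1, primorialAboveFive k ∣ p - 1 := fun k => by
    induction k with
    | zero => exact fun _ => one_dvd _
    | succ k ih =>
      intro hk
      rw [primorialAboveFive_succ]
      exact Nat.Coprime.mul_dvd_of_dvd_of_dvd
        (Nat.Coprime.prod_left fun i hi => coprime_primeAboveFive (Finset.mem_range.1 hi).ne)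
        (ih (by omega)) ((Nat.modEq_iff_dvd' hp).1 (h.2.2 k (by omega)).symm)
  exact key _ le_rfl

theorem seven_le_of_mem_admissiblePrimes (hn : 2 ≤ n) (h : p ∈ admissiblePrimes n) : 7 ≤ p := by
  have h0 : primeAboveFive 0 ∣ p - 1 :=
    (Nat.modEq_iff_dvd' h.1.pos).1 (h.2.2 0 (by omega)).symm
  have := Nat.le_of_dvd (by have := h.1.two_le; omega) h0
  have := (primeAboveFive_spec 0).2
  omega

end Admissible

namespace Matrix.SpecialLinearGroup

variable {F : Type*} [Field F]

/-- The diagonal matrix with entries `u` and `u⁻¹`. -/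
def unitDiagonal (u : Fˣ) : SL(2, F) := ⟨!![(u : F), 0; 0, ((u⁻¹ : Fˣ) : F)], by simp⟩

theorem unitDiagonal_apply (u : Fˣ) : unitDiagonal u 0 0 = u ∧ unitDiagonal u 0 1 = 0 ∧
    unitDiagonal u 1 0 = 0 ∧ unitDiagonal u 1 1 = ((u⁻¹ : Fˣ) : F) := ⟨rfl, rfl, rfl, rfl⟩

/-- The diagonal torus of `SL₂`. -/
def diagonalHom : Fˣ →* SL(2, F) where
  toFun := unitDiagonal
  map_one' := by apply ext_two <;> simp [unitDiagonal_apply]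
  map_mul' u v := by
    apply ext_two <;> simp only [mul_apply_two, unitDiagonal_apply] <;> simp [mul_comm]

theorem diagonalHom_apply (u : Fˣ) : diagonalHom u 0 0 = u ∧ diagonalHom u 0 1 = 0 ∧
    diagonalHom u 1 0 = 0 ∧ diagonalHom u 1 1 = ((u⁻¹ : Fˣ) : F) := unitDiagonal_apply u

theorem diagonalHom_injective : Function.Injective (diagonalHom : Fˣ →* SL(2, F)) := by
  intro u v h
  have := congrArg (fun x : SL(2, F) => x 0 0) h
  exact Units.ext this

/-- The Borel subgroup of upper triangular matrices. -/
def borel (F : Type*) [Field F] : Subgroup SL(2, F) where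
  carrier := {x | x 1 0 = 0}
  one_mem' := rfl
  mul_mem' := fun {x y} hx hy => by
    change (x * y) 1 0 = 0
    rw [mul_apply_two, show x 1 0 = 0 from hx, show y 1 0 = 0 from hy]
    ring
  inv_mem' := fun {x} hx => by
    change x⁻¹ 1 0 = 0
    rw [(inv_apply_two x).2.2.1, show x 1 0 = 0 from hx, neg_zero]

theorem mem_borel (x : SL(2, F)) : x ∈ borel F ↔ x 1 0 = 0 := Iff.rfl

theorem borel_lt_top : borel F < ⊤ := by
  refine lt_top_iff_ne_top.2 fun h => ?_
  have : lower (1 : F) ∈ borel F := h ▸ Subgroup.mem_top _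
  rw [mem_borel, (lower_apply (1 : F)).2.2.1] at this
  exact one_ne_zero this

theorem map_diagonalHom_lt_borel (H : Subgroup Fˣ) : H.map diagonalHom < borel F := by
  refine lt_of_le_of_ne ?_ fun h => ?_
  · rintro _ ⟨u, -, rfl⟩
    exact (diagonalHom_apply u).2.2.1
  · have : upper (1 : F) ∈ H.map diagonalHom := by
      rw [h]; exact (upper_apply (1 : F)).2.2.1
    obtain ⟨u, -, hu⟩ := this
    have h1 := (diagonalHom_apply u).2.1
    rw [hu, (upper_apply (1 : F)).2.1] at h1
    exact one_ne_zero h1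

theorem map_diagonalHom_rootsOfUnity_two :
    (rootsOfUnity 2 F).map diagonalHom = Subgroup.center SL(2, F) := by
  ext x
  rw [mem_center_iff_eq_one_or_neg_one, Subgroup.mem_map]
  constructor
  · rintro ⟨u, hu, rfl⟩
    rw [mem_rootsOfUnity] at hu
    have h1 : (diagonalHom u : SL(2, F)) ∈ Subgroup.center SL(2, F) := by
      rw [mem_center_iff_apply]
      refine ⟨rfl, rfl, ?_⟩
      rw [(diagonalHom_apply u).1, (diagonalHom_apply u).2.2.2]
      congr 1
      rw [eq_inv_iff_mul_eq_one, ← sq, hu]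
    exact (mem_center_iff_eq_one_or_neg_one _).1 h1
  · rintro (rfl | rfl)
    · exact ⟨1, one_mem _, map_one _⟩
    · refine ⟨-1, by simp, ?_⟩
      apply ext_two <;> simp [diagonalHom_apply]

end Matrix.SpecialLinearGroup

theorem rootsOfUnity_lt_of_dvd {p : ℕ} [Fact p.Prime] {d e : ℕ} (hde : d ∣ e) (hlt : d < e)
    (hd : d ≠ 0) (he : e ∣ p - 1) : rootsOfUnity d (ZMod p) < rootsOfUnity e (ZMod p) := by
  refine lt_of_le_of_ne (rootsOfUnity_le_of_dvd hde) fun h => ?_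
  obtain ⟨g, hg⟩ := IsCyclic.exists_generator (α := (ZMod p)ˣ)
  have hog : orderOf g = p - 1 := by
    rw [orderOf_eq_card_of_forall_mem_zpowers hg, Nat.card_eq_fintype_card, ZMod.card_units p]
  obtain ⟨c, hc⟩ := he
  have hp1 : p - 1 ≠ 0 := by have := (Fact.out : p.Prime).two_le; omega
  have hc0 : c ≠ 0 := by rintro rfl; exact hp1 (by simpa using hc)
  have ho : orderOf (g ^ c) = e := by
    rw [orderOf_pow_of_dvd hc0 (by rw [hog, hc]; exact dvd_mul_left _ _), hog, hc,
      Nat.mul_div_cancel _ (Nat.pos_of_ne_zero hc0)]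
  have hm : g ^ c ∈ rootsOfUnity d (ZMod p) := by
    rw [h, mem_rootsOfUnity, ← ho, pow_orderOf_eq_one]
  rw [mem_rootsOfUnity] at hm
  have := Nat.le_of_dvd (Nat.pos_of_ne_zero hd) (ho ▸ orderOf_dvd_of_pow_eq_one hm)
  omega

namespace L2

open Matrix.SpecialLinearGroup

variable {n p : ℕ} [Fact p.Prime]

theorem lt_groupLength (hn : 1 ≤ n) (hd : 2 * primorialAboveFive (n - 1) ∣ p - 1) :
    (n : ℕ∞) < groupLength (L2 p) := by
  set f : ℕ → Subgroup SL(2, ZMod p) := fun m =>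
    if m < n then (rootsOfUnity (2 * primorialAboveFive m) (ZMod p)).map diagonalHom
    else if m = n then borel (ZMod p) else ⊤ with hf
  have h := le_groupLength_quotient (N := Subgroup.center SL(2, ZMod p)) (t := n + 1) (f := f)
    ?_ ?_ ?_
  · refine lt_of_lt_of_le ?_ h
    exact_mod_cast Nat.lt_succ_self n
  · have h0 : primorialAboveFive 0 = 1 := rfl
    rw [hf]
    simp only [if_pos (show 0 < n by omega), h0, mul_one]
    exact map_diagonalHom_rootsOfUnity_two
  · simp [hf]
  · intro m hm
    simp only [hf]
    rcases lt_trichotomy (m + 1) n with h1 | h1 | h1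
    · rw [if_pos (by omega), if_pos h1]
      refine (Subgroup.map_lt_map_iff_of_injective diagonalHom_injective).2 ?_
      have hpos := primorialAboveFive_pos m
      refine rootsOfUnity_lt_of_dvd ?_ ?_ (by omega) (Dvd.dvd.trans ?_ hd)
      · rw [primorialAboveFive_succ, ← mul_assoc]; exact dvd_mul_right _ _
      · rw [primorialAboveFive_succ]
        have := (primeAboveFive_spec m).2
        nlinarith
      · exact mul_dvd_mul_left 2 (Finset.prod_dvd_prod_of_subset _ _ _
          (Finset.range_subset_range.2 (by omega)))
    · rw [if_pos (by omega), if_neg (by omega), if_pos h1]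
      exact map_diagonalHom_lt_borel _
    · rw [if_neg (by omega), if_pos (by omega), if_neg (by omega), if_neg (by omega)]
      exact borel_lt_top

theorem isFiniteNonabelianSimple (hp : 4 ≤ p) : IsFiniteNonabelianSimple (L2 p) where
  finite := inferInstance
  simple := Matrix.ProjectiveSpecialLinearGroup.rank_two_simple (by simpa using hp)
  nonabelian := by
    refine ⟨QuotientGroup.mk (upper 1), QuotientGroup.mk (lower 1), fun h => ?_⟩
    rw [← QuotientGroup.mk_mul, ← QuotientGroup.mk_mul, QuotientGroup.eq,
      mem_center_iff_eq_one_or_neg_one, inv_mul_eq_iff_eq_mul, inv_mul_eq_iff_eq_mul] at h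
    rcases h with h | h
    · have h1 := congrArg (fun x : SL(2, ZMod p) => x 0 0) h
      simp [mul_apply_two, upper_apply, lower_apply] at h1
    · rw [mul_neg_one] at h
      have h1 : (lower 1 * upper 1 : SL(2, ZMod p)) 0 0 =
          -(upper 1 * lower 1 : SL(2, ZMod p)) 0 0 :=
        congrArg (fun x : SL(2, ZMod p) => x 0 0) h
      have h2 : (lower 1 * upper 1 : SL(2, ZMod p)) 0 1 =
          -(upper 1 * lower 1 : SL(2, ZMod p)) 0 1 :=
        congrArg (fun x : SL(2, ZMod p) => x 0 1) h
      simp only [mul_apply_two, upper_apply, lower_apply] at h1 h2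
      have h3 : (1 : ZMod p) = 0 := by linear_combination 2 * h2 - h1
      exact one_ne_zero h3

theorem groupDepth_eq_three (hp : 7 ≤ p)
    (hmod : p % 40 = 3 ∨ p % 40 = 37 ∨ p % 40 = 13 ∨ p % 40 = 27) :
    groupDepth (L2 p) = 3 := by
  have hG := isFiniteNonabelianSimple (p := p) (by omega)
  have := hG.finite
  have := hG.simple
  refine le_antisymm ?_ (three_le_groupDepth hG.nonabelian)
  have h2 : (2 : ZMod p) ≠ 0 := by
    intro h
    have h' : ((2 : ℕ) : ZMod p) = 0 := by exact_mod_cast h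
    rw [ZMod.natCast_eq_zero_iff] at h'
    have := Nat.le_of_dvd (by norm_num) h'
    omega
  obtain ⟨i, j, w, h⟩ := exists_isTetrahedralTriple h2
  have hcard : 48 < Nat.card SL(2, ZMod p) := by
    rw [card_eq]
    have : 7 ^ 2 ≤ p ^ 2 := Nat.pow_le_pow_left hp 2
    have h48 : 48 ≤ p ^ 2 - 1 := by omega
    nlinarith
  have hA := binaryTetrahedral_covBy_top h h2 (by rw [card_eq]; exact not_sixteen_dvd hmod)
    (by rw [card_eq]; exact not_five_dvd hmod) hcard
  have hC := h.zpowers_covBy_binaryTetrahedral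
  have hZ := h.covBy_zpowers (Z := Subgroup.center SL(2, ZMod p)) mem_center_iff_eq_one_or_neg_one
  have hA' := Subgroup.map_mk'_covBy (hZ.le.trans hC.le) hA
  have hC' := Subgroup.map_mk'_covBy hZ.le hC
  have hZ' := Subgroup.map_mk'_covBy le_rfl hZ
  rw [Subgroup.map_mk'_top] at hA'
  rw [QuotientGroup.map_mk'_self] at hZ'
  exact groupDepth_le_three hA' hC' hZ'

end L2

theorem admissiblePrimes_spec {n p : ℕ} (hn : 2 ≤ n) (hp : p ∈ admissiblePrimes n) :
    IsFiniteNonabelianSimple (L2 p) ∧ groupDepth (L2 p) = 3 ∧ (n : ℕ∞) < groupLength (L2 p) := by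
  have : Fact p.Prime := ⟨hp.1⟩
  have h7 := seven_le_of_mem_admissiblePrimes hn hp
  exact ⟨L2.isFiniteNonabelianSimple (by omega),
    L2.groupDepth_eq_three h7 (mod_forty_of_mem_admissiblePrimes hp),
    L2.lt_groupLength (by omega) (two_mul_primorial_dvd hp)⟩

theorem theorem6 :
    (∀ n : ℕ, ∃ (G : Type) (_ : Group G),
      IsFiniteNonabelianSimple G ∧ groupDepth G = 3 ∧ (n : ℕ∞) < groupLength G) ∧
    (∀ n : ℕ, ∃ p : ℕ, p.Prime ∧
      IsFiniteNonabelianSimple (L2 p) ∧ groupDepth (L2 p) = 3 ∧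
        (n : ℕ∞) < groupLength (L2 p)) ∧
    (∀ n : ℕ, 2 ≤ n →
      (admissiblePrimes n).Infinite ∧
      ∀ p ∈ admissiblePrimes n,
        IsFiniteNonabelianSimple (L2 p) ∧ groupDepth (L2 p) = 3 ∧
          (n : ℕ∞) < groupLength (L2 p)) := by
  have key : ∀ n : ℕ, ∃ p : ℕ, p.Prime ∧
      IsFiniteNonabelianSimple (L2 p) ∧ groupDepth (L2 p) = 3 ∧
        (n : ℕ∞) < groupLength (L2 p) := fun n => by
    obtain ⟨p, hp⟩ := (admissiblePrimes_infinite (n + 2)).nonempty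
    obtain ⟨h1, h2, h3⟩ := admissiblePrimes_spec (by omega) hp
    refine ⟨p, hp.1, h1, h2, lt_of_le_of_lt ?_ h3⟩
    exact_mod_cast Nat.le_add_right n 2
  refine ⟨fun n => ?_, key, fun n hn => ⟨admissiblePrimes_infinite n, fun p hp =>
    admissiblePrimes_spec hn hp⟩⟩
  obtain ⟨p, -, h⟩ := key n
  exact ⟨L2 p, inferInstance, h⟩
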